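/- Theorem 7.4 (eigenvector structure). Definitions. Let $c_0,c_1\in(0,1)$ and $c_2:=\tfrac14c_0c_1^2$. A unit vector $x\in\mathbb{R}^n$ is *compressible* if it is within Euclidean distance $c_1$ of some vector whose support has at most $c_0n$ elements, and *incompressible* otherwise; $\mathrm{Incomp}(c_0,c_1)$ is the set of incompressible unit vectors. To each $x\in\mathrm{Incomp}(c_0,c_1)$ assign a set $\mathrm{spread}(x)\subseteq\{1,\dots,n\}$ with $|\mathrm{spread}(x)|=\lceil c_2n\rceil$ such that $\frac{c_1}{\sqrt{2n}}\le|x_k|\le\frac1{\sqrt{c_0n}}$ for all $k\in\mathrm{spread}(x)$; any such assignment is allowed. For $L\ge1$, a finite index set $I$ and a unit vector $y\in\mathbb{R}^I$ let $$D_L(y):=\inf\{\theta>0:\ \mathrm{dist}(\theta y,\mathbb{Z}^I)<L\sqrt{\log_+(\theta/L)}\},$$ and for $\gamma\in(0,c_2)$ and $x\in\mathrm{Incomp}(c_0,c_1)$ let the *regularized LCD* be $$\widehat D_L(x,\gamma):=\max\{D_L(x_I/\|x_I\|):\ I\subseteq\mathrm{spread}(x),\ |I|=\lceil\gamma n\rceil\},$$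 where $x_I\in\mathbb{R}^I$ is the restriction of $x$ to the coordinates in $I$. Given real random variables $\xi,\zeta$, an $n\times n$ *Wigner matrix* with atom variables $\xi$ and $\zeta$ is a random real symmetric matrix $W=(w_{ij})$ such that the entries $w_{ij}$, $i\le j$, are independent, those with $i<j$ are distributed as $\xi$, and those with $i=j$ are distributed as $\zeta$. $\|W\|$ denotes the spectral norm (largest singular value). Statement. Let $\varepsilon_0,p_0,K_0>0$, $M\ge1$, $\alpha>0$ and $c_0,c_1\in(0,1)$. Then there are constants $C,c,c'>0$ and $\gamma\in(0,c_2)$, depending only on $c_0,c_1,\varepsilon_0,p_0,K_0,\alpha,M$, such that the following holds. Let $\xi,\zeta$ be real random variables such that $$\mathbb{P}(|\xi-\xi'|\le\varepsilon_0)\le1-p_0,\qquad \mathbb{P}(|\xi|>K_0)\le p_0/4,$$ where $\xi'$ is an independent copy of $\xi$. Let $W$ be an $n\times n$ Wigner matrix with atom variables $\xi$ and $\zeta$, and fix any valid assignment $x\mapsto\mathrm{spread}(x)$ on $\mathrm{Incomp}(c_0,c_1)$. Then, for every $L$ with $p_0^{-1/2}\le L\le n^{c}$, $$\mathbb{P}\Bigl(\exists\text{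 an eigenvector } v \text{ of } W:\ v\in\mathrm{Incomp}(c_0,c_1),\ \widehat D_L(v,\gamma)\le n^{\alpha},\ \text{ and }\ \|W\|\le M\sqrt n\Bigr)\le C\,n^{-c'n}.$$ (For assignments for which this event is not measurable, $\mathbb{P}$ denotes outer probability.) -/

import Mathlib

open MeasureTheory ProbabilityTheory

noncomputable section

namespace WignerLCD

/-- The non-degeneracy condition on a real random variable `ξ` with parameters `ε₀, p₀, K₀`:
`P(|ξ - ξ'| ≤ ε₀) ≤ 1 - p₀` and `P(|ξ| > K₀) ≤ p₀ / 4`, where `ξ'` is an independent copy of `ξ`.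
The pair `(ξ, ξ')` has law `law(ξ) ⊗ law(ξ)`. -/
def Nondegenerate {Ω : Type*} [MeasurableSpace Ω] (P : Measure Ω) (ξ : Ω → ℝ)
    (ε₀ p₀ K₀ : ℝ) : Prop :=
  ((P.map ξ).prod (P.map ξ)).real {z : ℝ × ℝ | |z.1 - z.2| ≤ ε₀} ≤ 1 - p₀ ∧
    P.real {ω | K₀ < |ξ ω|} ≤ p₀ / 4

/-- `W`, defined on the probability space `(Ω, P)`, is an `n × n` Wigner matrix with atom variables
`ξ` and `ζ`, which live on a (possibly different) probability space `(Ω₀, P₀)`. -/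
structure IsWigner {Ω Ω₀ : Type*} [MeasurableSpace Ω] [MeasurableSpace Ω₀]
    (P : Measure Ω) (P₀ : Measure Ω₀) (ξ ζ : Ω₀ → ℝ) {n : ℕ}
    (W : Ω → Matrix (Fin n) (Fin n) ℝ) : Prop where
  measurable_entry : ∀ i j, Measurable fun ω => W ω i j
  isSymm : ∀ ω, (W ω).IsSymm
  iIndep : iIndepFun
    (fun (p : {p : Fin n × Fin n // p.1 ≤ p.2}) (ω : Ω) => W ω p.1.1 p.1.2) P
  upper : ∀ i j, i < j → IdentDistrib (fun ω => W ω i j) ξ P P₀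
  diag : ∀ i, IdentDistrib (fun ω => W ω i i) ζ P P₀

/-- The spectral norm (largest singular value) of a real square matrix: its operator norm with
respect to the Euclidean norm. -/
def spectralNorm {n : ℕ} (A : Matrix (Fin n) (Fin n) ℝ) : ℝ :=
  ‖Matrix.toEuclideanCLM (n := Fin n) (𝕜 := ℝ) A‖

/-- `v` is a (nonzero, real) eigenvector of the real matrix `A`. -/
def IsEigenvector {n : ℕ} (A : Matrix (Fin n) (Fin n) ℝ) (v : EuclideanSpace ℝ (Fin n)) : Prop :=
  ∃ μ : ℝ, Module.End.HasEigenvector (Matrix.toEuclideanLin A) μ v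

/-- Vectors of `ℝⁿ` whose support has at most `c₀ n` elements. -/
def sparse (c₀ : ℝ) (n : ℕ) : Set (EuclideanSpace ℝ (Fin n)) :=
  {y | ({k | y k ≠ 0} : Set (Fin n)).ncard ≤ c₀ * n}

/-- Compressible unit vectors: those within Euclidean distance `c₁` of the sparse vectors. -/
def comp (c₀ c₁ : ℝ) (n : ℕ) : Set (EuclideanSpace ℝ (Fin n)) :=
  {x | ‖x‖ = 1 ∧ ∃ y ∈ sparse c₀ n, dist x y ≤ c₁}

/-- Incompressible unit vectors: the unit vectors that are not compressible. -/
def incomp (c₀ c₁ : ℝ) (n : ℕ) : Set (EuclideanSpace ℝ (Fin n)) :=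
  {x | ‖x‖ = 1 ∧ x ∉ comp c₀ c₁ n}

/-- The integer lattice in Euclidean space. -/
def intLattice (ι : Type*) : Set (EuclideanSpace ℝ ι) :=
  {y | ∀ i, ∃ k : ℤ, y i = k}

/-- The least common denominator
`D_L(x) = inf {θ > 0 : dist(θ x, ℤ^ι) < L √(log₊ (θ / L))}`. -/
def lcd {ι : Type*} [Fintype ι] (L : ℝ) (x : EuclideanSpace ℝ ι) : ℝ :=
  sInf {θ : ℝ | 0 < θ ∧
    Metric.infDist (θ • x) (intLattice ι) < L * √(Real.posLog (θ / L))}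

/-- The restriction `x_I ∈ ℝ^I` of a vector to a set of coordinates. -/
def restrict {n : ℕ} (x : EuclideanSpace ℝ (Fin n)) (I : Finset (Fin n)) :
    EuclideanSpace ℝ I :=
  WithLp.toLp 2 fun i : I => x i

/-- The constant `c₂ = c₀ c₁² / 4`. -/
def spreadConst (c₀ c₁ : ℝ) : ℝ := c₀ * c₁ ^ 2 / 4

/-- `spread` is a valid assignment `x ↦ spread(x)`: to every incompressible `x` it attaches
a set of exactly `⌈c₂ n⌉` coordinates with `c₁ / √(2n) ≤ |x_k| ≤ 1 / √(c₀ n)`. -/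
def IsSpread (c₀ c₁ : ℝ) {n : ℕ}
    (spread : EuclideanSpace ℝ (Fin n) → Finset (Fin n)) : Prop :=
  ∀ x ∈ incomp c₀ c₁ n,
    (spread x).card = ⌈spreadConst c₀ c₁ * n⌉₊ ∧
      ∀ k ∈ spread x, c₁ / √(2 * n) ≤ |x k| ∧ |x k| ≤ 1 / √(c₀ * n)

/-- The regularized LCD:
the maximum of `D_L(x_I / ‖x_I‖)` over `I ⊆ spread(x)` with `|I| = ⌈γ n⌉`
(the supremum is over a finite set, nonempty when `0 < γ < c₂` and `x` is incompressible). -/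
def regLCD {n : ℕ} (spread : EuclideanSpace ℝ (Fin n) → Finset (Fin n))
    (L γ : ℝ) (x : EuclideanSpace ℝ (Fin n)) : ℝ :=
  sSup {D : ℝ | ∃ I : Finset (Fin n), I ⊆ spread x ∧ I.card = ⌈γ * n⌉₊ ∧
    D = lcd L (‖restrict x I‖⁻¹ • restrict x I)}

end WignerLCD

end

/-!
The event is covered by events `‖(W - ν) x‖ ≤ (z / D) √n`, where `z = n ^ δ` is a small power of `n`,
which absorbs all constants, logarithms and powers of `L`. Here `D` runs over the positive integers
up to about `n ^ α`, the vector `x` over a net of the level set `S_D` of incompressible vectors with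
regularized LCD in `[D - 1, D)`, and `ν` over a grid of approximate eigenvalues. Two estimates are
played off against each other. Throughout, `m = ⌈γ n⌉`.

*Small ball probability* (`IsWigner.measureReal_norm_sub_le`). Some block `I` of `m` spread
coordinates of `x` has LCD at least `D - 1`. A Gaussian function of the coordinates of `(W - ν) x`
outside `I` is a Gaussian average of characters of the entries of `W`. For fixed Gaussian variables
the entries in `Iᶜ × I` are independent and enter through the coefficients `g_i x_j`, so the
expectation is bounded by a product over the `n - m` rows of averages of `∏ j, |φ_ξ(g x_j / t)|`. By
`prod_norm_charFun_le` this characteristic function decays quadratically up to frequencies of order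
`D`. Hence the probability is at most `(z ^ 3 / D) ^ (n - m)`, up to a factor exponential in `n`.

*Size of the net* (`exists_codes`). The spread part of a vector of `S_D` contains `k` disjoint blocks
of size `m`, on each of which the regularized LCD provides a dilation taking the vector close to the
integer lattice. The dilation factors, the lattice points and the remaining small errors, rounded
to a grid, determine the vector up to `2 / D`, and counting lattice points shows that there are at
most about `D ^ n / √n ^ (k m)` such codes, up to powers `z ^ O(n)`.

The product of the two bounds is `z ^ O(n) * D ^ m / √n ^ (k m)`. With `k ≥ 8 α` and `γ = c₂ / (2 k)`,
the gain `n ^ (k m / 2)`, at least `n ^ (c₂ n / 4)`, dominates the loss `D ^ m`, about `n ^ (α m)`, and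
a small `δ` makes the factor `z ^ O(n)` harmless.
-/

namespace WignerLCD

/-! ### The least common denominator -/

lemma intLattice_nonempty (ι : Type*) : (intLattice ι).Nonempty :=
  ⟨0, fun _ => ⟨0, by simp⟩⟩

lemma mul_sqrt_posLog_div_le {L θ : ℝ} (hL : 0 < L) (hθ : 0 < θ) :
    L * √(Real.posLog (θ / L)) ≤ θ := by
  have hu : 0 < θ / L := div_pos hθ hL
  have h : √(Real.posLog (θ / L)) ≤ θ / L := by
    refine Real.sqrt_le_iff.2 ⟨hu.le, ?_⟩
    rw [Real.posLog_apply]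
    refine max_le (sq_nonneg _) ?_
    nlinarith [Real.log_le_sub_one_of_pos hu, sq_nonneg (θ / L - 1)]
  calc L * √(Real.posLog (θ / L)) ≤ L * (θ / L) := by gcongr
    _ = θ := by field_simp

/-- A multiple of a spread unit vector can only be near the integer lattice if its largest
coordinate is at least `1 / 2`: otherwise the nearest lattice point is the origin, at distance `θ`,
whereas `L √(log₊ (θ / L)) ≤ θ`. -/
lemma half_le_mul_of_infDist_lt {ι : Type*} [Fintype ι] {L b θ : ℝ} {y : EuclideanSpace ℝ ι}
    (hy : ‖y‖ = 1) (hL : 0 < L) (hθ : 0 < θ) (hb : ∀ i, |y i| ≤ b)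
    (h : Metric.infDist (θ • y) (intLattice ι) < L * √(Real.posLog (θ / L))) :
    1 / 2 ≤ θ * b := by
  by_contra! hlt
  refine absurd h (not_lt.2 ((mul_sqrt_posLog_div_le hL hθ).trans ?_))
  rw [Metric.le_infDist (intLattice_nonempty ι)]
  intro p hp
  have h1 : ‖θ • y‖ = θ := by rw [norm_smul, hy, Real.norm_of_nonneg hθ.le, mul_one]
  calc θ = ‖θ • y‖ := h1.symm
    _ ≤ ‖θ • y - p‖ := by
      rw [EuclideanSpace.norm_eq, EuclideanSpace.norm_eq]
      refine Real.sqrt_le_sqrt (Finset.sum_le_sum fun i _ => ?_)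
      obtain ⟨k, hk⟩ := hp i
      have hyi : |θ * y i| < 1 / 2 := by
        rw [abs_mul, abs_of_pos hθ]
        exact (mul_le_mul_of_nonneg_left (hb i) hθ.le).trans_lt hlt
      simp only [PiLp.smul_apply, PiLp.sub_apply, smul_eq_mul, Real.norm_eq_abs, hk]
      refine pow_le_pow_left₀ (abs_nonneg _) ?_ 2
      rcases eq_or_ne k 0 with rfl | hk0
      · simp
      · have : (1 : ℝ) ≤ |(k : ℝ)| := by exact_mod_cast Int.one_le_abs hk0
        have h3 := abs_sub_abs_le_abs_sub (k : ℝ) (θ * y i)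
        rw [abs_sub_comm] at h3
        linarith
    _ = dist (θ • y) p := (dist_eq_norm _ _).symm

lemma infDist_intLattice_le {ι : Type*} [Fintype ι] (x : EuclideanSpace ℝ ι) :
    Metric.infDist x (intLattice ι) ≤ √(∑ i, (x i - round (x i)) ^ 2) := by
  refine (Metric.infDist_le_dist_of_mem
    (y := (WithLp.toLp 2 fun i => ((round (x i) : ℤ) : ℝ))) fun i => ⟨round (x i), rfl⟩).trans ?_
  rw [EuclideanSpace.dist_eq]
  simp [Real.dist_eq]

lemma lcd_set_nonempty {ι : Type*} [Fintype ι] {L : ℝ} (hL : 0 < L) (x : EuclideanSpace ℝ ι) :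
    {θ : ℝ | 0 < θ ∧
      Metric.infDist (θ • x) (intLattice ι) < L * √(Real.posLog (θ / L))}.Nonempty := by
  refine ⟨L * Real.exp (((Fintype.card ι : ℝ) + 1) / L ^ 2), by positivity, ?_⟩
  have h1 : L * Real.exp (((Fintype.card ι : ℝ) + 1) / L ^ 2) / L =
      Real.exp (((Fintype.card ι : ℝ) + 1) / L ^ 2) := by field_simp
  rw [h1]
  have h2 : Real.posLog (Real.exp (((Fintype.card ι : ℝ) + 1) / L ^ 2)) =
      ((Fintype.card ι : ℝ) + 1) / L ^ 2 := by
    rw [Real.posLog_apply, Real.log_exp, max_eq_right (by positivity)]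
  rw [h2, Real.sqrt_div (by positivity), Real.sqrt_sq hL.le, mul_div_cancel₀ _ hL.ne']
  refine (infDist_intLattice_le _).trans_lt (Real.sqrt_lt_sqrt (by positivity) ?_)
  have : ∀ u : ℝ, (u - round u) ^ 2 ≤ 1 := fun u => by
    have := abs_le.1 (abs_sub_round u)
    nlinarith
  calc _ ≤ ∑ i : ι, (1 : ℝ) := Finset.sum_le_sum fun i _ => this _
    _ < _ := by simp

lemma exists_int_near_of_lcd_lt {ι : Type*} [Fintype ι] {L D : ℝ} (hL : 0 < L)
    {x : EuclideanSpace ℝ ι} (h : lcd L x < D) :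
    ∃ θ : ℝ, 0 < θ ∧ θ < D ∧
      Metric.infDist (θ • x) (intLattice ι) < L * √(Real.posLog (θ / L)) := by
  obtain ⟨θ, ⟨h0, h1⟩, h2⟩ := exists_lt_of_csInf_lt (lcd_set_nonempty hL x) h
  exact ⟨θ, h0, h2, h1⟩

lemma le_infDist_of_lt_lcd {ι : Type*} [Fintype ι] {L θ : ℝ}
    {x : EuclideanSpace ℝ ι} (hθ : 0 < θ) (h : θ < lcd L x) :
    L * √(Real.posLog (θ / L)) ≤ Metric.infDist (θ • x) (intLattice ι) := by
  have := notMem_of_lt_csInf h ⟨0, fun θ hθ => hθ.1.le⟩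
  by_contra! h'
  exact this ⟨hθ, h'⟩

lemma finite_regLCD_set {n : ℕ} (spread : EuclideanSpace ℝ (Fin n) → Finset (Fin n))
    (L γ : ℝ) (x : EuclideanSpace ℝ (Fin n)) :
    {D : ℝ | ∃ I : Finset (Fin n), I ⊆ spread x ∧ I.card = ⌈γ * n⌉₊ ∧
      D = lcd L (‖restrict x I‖⁻¹ • restrict x I)}.Finite := by
  refine (Set.finite_range fun I : Finset (Fin n) =>
    lcd L (‖restrict x I‖⁻¹ • restrict x I)).subset ?_
  rintro D ⟨I, -, -, rfl⟩
  exact ⟨I, rfl⟩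

lemma lcd_le_regLCD {n : ℕ} {spread : EuclideanSpace ℝ (Fin n) → Finset (Fin n)}
    {L γ : ℝ} {x : EuclideanSpace ℝ (Fin n)} {I : Finset (Fin n)} (hI : I ⊆ spread x)
    (hc : I.card = ⌈γ * n⌉₊) :
    lcd L (‖restrict x I‖⁻¹ • restrict x I) ≤ regLCD spread L γ x :=
  le_csSup (finite_regLCD_set spread L γ x).bddAbove ⟨I, hI, hc, rfl⟩

lemma exists_lcd_eq_regLCD {n : ℕ} {spread : EuclideanSpace ℝ (Fin n) → Finset (Fin n)}
    {L γ : ℝ} {x : EuclideanSpace ℝ (Fin n)} (hc : ⌈γ * n⌉₊ ≤ (spread x).card) :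
    ∃ I : Finset (Fin n), I ⊆ spread x ∧ I.card = ⌈γ * n⌉₊ ∧
      regLCD spread L γ x = lcd L (‖restrict x I‖⁻¹ • restrict x I) := by
  obtain ⟨I, hI, hIc⟩ := Finset.exists_subset_card_eq hc
  have h : regLCD spread L γ x ∈ {D : ℝ | ∃ I : Finset (Fin n), I ⊆ spread x ∧
      I.card = ⌈γ * n⌉₊ ∧ D = lcd L (‖restrict x I‖⁻¹ • restrict x I)} :=
    Set.Nonempty.csSup_mem ⟨_, I, hI, hIc, rfl⟩ (finite_regLCD_set spread L γ x)
  exact h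

lemma norm_restrict_sq {n : ℕ} (x : EuclideanSpace ℝ (Fin n)) (I : Finset (Fin n)) :
    ‖restrict x I‖ ^ 2 = ∑ i ∈ I, x i ^ 2 := by
  rw [EuclideanSpace.norm_sq_eq, ← Finset.sum_coe_sort I]
  simp [restrict]

lemma norm_restrict_le {n : ℕ} (x : EuclideanSpace ℝ (Fin n)) (I : Finset (Fin n)) :
    ‖restrict x I‖ ≤ ‖x‖ := by
  refine le_of_sq_le_sq ?_ (norm_nonneg _)
  rw [norm_restrict_sq, EuclideanSpace.norm_sq_eq]
  simp only [Real.norm_eq_abs, sq_abs]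
  exact Finset.sum_le_univ_sum_of_nonneg fun i => sq_nonneg _

/-! ### Decay of the characteristic function of a linear form -/

lemma sq_norm_charFun (μ : Measure ℝ) [IsProbabilityMeasure μ] (τ : ℝ) :
    ‖charFun μ τ‖ ^ 2 = ∫ z, Real.cos (τ * (z.1 - z.2)) ∂(μ.prod μ) := by
  have h1 : (starRingEnd ℂ) (charFun μ τ) = ∫ y, Complex.exp (-(τ * y * Complex.I)) ∂μ := by
    rw [charFun_apply_real, ← integral_conj]
    congr 1 with y
    rw [← Complex.exp_conj]
    simp
  have h2 : charFun μ τ * (starRingEnd ℂ) (charFun μ τ) =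
      ∫ z, Complex.exp ((τ * (z.1 - z.2) : ℝ) * Complex.I) ∂(μ.prod μ) := by
    rw [h1, charFun_apply_real, ← integral_prod_mul]
    congr 1 with z
    rw [← Complex.exp_add]
    congr 1
    push_cast
    ring
  have h3 : Integrable (fun z : ℝ × ℝ => Complex.exp ((τ * (z.1 - z.2) : ℝ) * Complex.I))
      (μ.prod μ) := by
    refine Integrable.of_bound (by fun_prop) 1 (Filter.Eventually.of_forall fun z => ?_)
    rw [Complex.norm_exp_ofReal_mul_I]
  have h4 := congrArg Complex.re h2
  rw [Complex.mul_conj, Complex.ofReal_re, Complex.normSq_eq_norm_sq] at h4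
  rw [h4]
  have := integral_re h3
  simp only [RCLike.re_to_complex] at this
  rw [← this]
  simp only [Complex.exp_ofReal_mul_I_re]

lemma integrable_one_sub_cos (μ : Measure ℝ) [IsProbabilityMeasure μ] (τ : ℝ) :
    Integrable (fun z : ℝ × ℝ => 1 - Real.cos (τ * (z.1 - z.2))) (μ.prod μ) := by
  refine Integrable.of_bound (by fun_prop) 2 (Filter.Eventually.of_forall fun z => ?_)
  have := Real.neg_one_le_cos (τ * (z.1 - z.2))
  have := Real.cos_le_one (τ * (z.1 - z.2))
  rw [Real.norm_eq_abs, abs_le]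
  constructor <;> linarith

lemma norm_charFun_le_exp (μ : Measure ℝ) [IsProbabilityMeasure μ] (τ : ℝ) :
    ‖charFun μ τ‖ ≤ Real.exp (-(1 / 2) * ∫ z, (1 - Real.cos (τ * (z.1 - z.2))) ∂(μ.prod μ)) := by
  have hi : Integrable (fun z : ℝ × ℝ => Real.cos (τ * (z.1 - z.2))) (μ.prod μ) := by
    refine Integrable.of_bound (by fun_prop) 1 (Filter.Eventually.of_forall fun z => ?_)
    exact Real.abs_cos_le_one _
  rw [integral_sub (integrable_const _) hi, ← sq_norm_charFun]
  refine le_of_sq_le_sq ?_ (Real.exp_nonneg _)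
  rw [← Real.exp_nat_mul]
  have := Real.add_one_le_exp (‖charFun μ τ‖ ^ 2 - 1)
  refine le_trans (by linarith) (this.trans_eq ?_)
  congr 1
  simp

lemma eight_mul_sq_le_one_sub_cos (u : ℝ) :
    8 * (u - round u) ^ 2 ≤ 1 - Real.cos (2 * Real.pi * u) := by
  have h := abs_sub_round u
  have hpi := Real.pi_pos
  have h1 : |2 * Real.pi * (u - round u)| ≤ Real.pi := by
    rw [abs_mul, abs_of_pos (by positivity)]
    nlinarith
  have h2 := Real.cos_le_one_sub_mul_cos_sq h1
  have h3 : Real.cos (2 * Real.pi * (u - round u)) = Real.cos (2 * Real.pi * u) := by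
    rw [show 2 * Real.pi * (u - round u) = 2 * Real.pi * u - (round u : ℤ) * (2 * Real.pi) by ring]
    exact Real.cos_sub_int_mul_two_pi _ _
  have h4 : 2 / Real.pi ^ 2 * (2 * Real.pi * (u - round u)) ^ 2 = 8 * (u - round u) ^ 2 := by
    field_simp
    ring
  rw [h3, h4] at h2
  linarith

/-- With probability at least `p₀ / 2` the symmetrization `ξ - ξ'` is neither small nor large. -/
lemma half_le_measureReal_symmetrization {μ : Measure ℝ} [IsProbabilityMeasure μ] {ε₀ p₀ K₀ : ℝ}
    (h1 : (μ.prod μ).real {z : ℝ × ℝ | |z.1 - z.2| ≤ ε₀} ≤ 1 - p₀)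
    (h2 : μ.real {x | K₀ < |x|} ≤ p₀ / 4) :
    p₀ / 2 ≤ (μ.prod μ).real {z : ℝ × ℝ | ε₀ < |z.1 - z.2| ∧ |z.1 - z.2| ≤ 2 * K₀} := by
  have hl : (μ.prod μ).real ({x | K₀ < |x|} ×ˢ Set.univ) ≤ p₀ / 4 := by
    rw [measureReal_prod_prod]; simpa using h2
  have hr : (μ.prod μ).real (Set.univ ×ˢ {x | K₀ < |x|}) ≤ p₀ / 4 := by
    rw [measureReal_prod_prod]; simpa using h2
  have hcov : (Set.univ : Set (ℝ × ℝ)) ⊆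
      {z : ℝ × ℝ | ε₀ < |z.1 - z.2| ∧ |z.1 - z.2| ≤ 2 * K₀} ∪
      ({z : ℝ × ℝ | |z.1 - z.2| ≤ ε₀} ∪
        (({x | K₀ < |x|} ×ˢ Set.univ) ∪ (Set.univ ×ˢ {x | K₀ < |x|}))) := by
    intro z _
    by_cases ha : |z.1 - z.2| ≤ ε₀
    · exact Or.inr (Or.inl ha)
    by_cases hb : K₀ < |z.1|
    · exact Or.inr (Or.inr (Or.inl ⟨hb, trivial⟩))
    by_cases hc : K₀ < |z.2|
    · exact Or.inr (Or.inr (Or.inr ⟨trivial, hc⟩))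
    · have := abs_sub z.1 z.2
      exact Or.inl ⟨not_le.1 ha, by linarith⟩
  have h := measureReal_mono (μ := μ.prod μ) hcov
  have e1 := measureReal_union_le (μ := μ.prod μ)
    {z : ℝ × ℝ | ε₀ < |z.1 - z.2| ∧ |z.1 - z.2| ≤ 2 * K₀} ({z : ℝ × ℝ | |z.1 - z.2| ≤ ε₀} ∪
        (({x | K₀ < |x|} ×ˢ Set.univ) ∪ (Set.univ ×ˢ {x | K₀ < |x|})))
  have e2 := measureReal_union_le (μ := μ.prod μ) {z : ℝ × ℝ | |z.1 - z.2| ≤ ε₀}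
        (({x | K₀ < |x|} ×ˢ Set.univ) ∪ (Set.univ ×ˢ {x | K₀ < |x|}))
  have e3 := measureReal_union_le (μ := μ.prod μ)
    ({x : ℝ | K₀ < |x|} ×ˢ (Set.univ : Set ℝ)) ((Set.univ : Set ℝ) ×ˢ {x : ℝ | K₀ < |x|})
  have e0 : (μ.prod μ).real (Set.univ : Set (ℝ × ℝ)) = 1 := by simp
  linarith

/-- The characteristic function of `∑ i, x i * ξ i` decays quadratically up to frequencies of the
order of the least common denominator of `x / ‖x‖`. -/
lemma prod_norm_charFun_le {μ : Measure ℝ} [IsProbabilityMeasure μ] {ε₀ p₀ K₀ L τ : ℝ}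
    (h1 : (μ.prod μ).real {z : ℝ × ℝ | |z.1 - z.2| ≤ ε₀} ≤ 1 - p₀)
    (h2 : μ.real {x | K₀ < |x|} ≤ p₀ / 4) (hε₀ : 0 < ε₀) (hL : 0 < L) (hLp : 1 ≤ p₀ * L ^ 2)
    {ι : Type*} [Fintype ι] {x : EuclideanSpace ℝ ι} (hx : 0 < ‖x‖)
    (hτ : |τ| * K₀ * ‖x‖ / Real.pi < lcd L (‖x‖⁻¹ • x)) :
    ∏ i, ‖charFun μ (τ * x i)‖ ≤ 2 / (1 + (ε₀ * ‖x‖ / (2 * Real.pi * L) * τ) ^ 2) := by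
  have hpi := Real.pi_pos
  rcases eq_or_ne τ 0 with rfl | hτ0
  · have : ∏ i, ‖charFun μ (0 * x i)‖ ≤ 1 :=
      Finset.prod_le_one (fun _ _ => norm_nonneg _) fun _ _ => norm_charFun_le_one _
    simp only [mul_zero]
    linarith
  have hτp : 0 < |τ| := abs_pos.2 hτ0
  set A : ℝ := |τ| * ε₀ * ‖x‖ / (2 * Real.pi * L) with hA
  have hA0 : 0 < A := by positivity
  set F : ℝ × ℝ → ℝ := fun z => ∑ i, (1 - Real.cos (τ * x i * (z.1 - z.2))) with hF
  have hFi : Integrable F (μ.prod μ) :=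
    integrable_finsetSum _ fun i _ => integrable_one_sub_cos μ (τ * x i)
  have hF0 : ∀ z, 0 ≤ F z := fun z => Finset.sum_nonneg fun i _ => by
    linarith [Real.cos_le_one (τ * x i * (z.1 - z.2))]
  have hprod : ∏ i, ‖charFun μ (τ * x i)‖ ≤ Real.exp (-(1 / 2) * ∫ z, F z ∂(μ.prod μ)) := by
    rw [hF, integral_finsetSum _ fun i _ => integrable_one_sub_cos μ (τ * x i), Finset.mul_sum,
      Real.exp_sum]
    exact Finset.prod_le_prod (fun _ _ => norm_nonneg _) fun i _ => norm_charFun_le_exp μ _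
  have hlow : ∀ z : ℝ × ℝ, ε₀ < |z.1 - z.2| ∧ |z.1 - z.2| ≤ 2 * K₀ →
      8 * (L ^ 2 * Real.posLog A) ≤ F z := by
    rintro z ⟨hz1, hz2⟩
    set w := |z.1 - z.2| with hw
    have hw0 : 0 < w := hε₀.trans hz1
    set θ : ℝ := |τ| * w * ‖x‖ / (2 * Real.pi) with hθ
    have hθ0 : 0 < θ := by positivity
    have hθl : θ < lcd L (‖x‖⁻¹ • x) := by
      refine lt_of_le_of_lt ?_ hτ
      rw [hθ, div_le_div_iff₀ (by positivity) hpi]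
      have : |τ| * w * ‖x‖ ≤ |τ| * (2 * K₀) * ‖x‖ := by gcongr
      nlinarith
    have hd := (le_infDist_of_lt_lcd hθ0 hθl).trans (infDist_intLattice_le _)
    have hAθ : A ≤ θ / L := by
      rw [hA, hθ, div_div]
      gcongr
    have hsq : L ^ 2 * Real.posLog A ≤
        ∑ i, ((θ • ‖x‖⁻¹ • x) i - round ((θ • ‖x‖⁻¹ • x) i)) ^ 2 := by
      have hs := pow_le_pow_left₀ (by positivity) hd 2
      rw [mul_pow, Real.sq_sqrt Real.posLog_nonneg,
        Real.sq_sqrt (Finset.sum_nonneg fun i _ => sq_nonneg _)] at hs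
      refine le_trans ?_ hs
      gcongr
    refine (mul_le_mul_of_nonneg_left hsq (by norm_num)).trans ?_
    rw [Finset.mul_sum]
    refine Finset.sum_le_sum fun i _ => (eight_mul_sq_le_one_sub_cos _).trans_eq ?_
    congr 1
    have hval : 2 * Real.pi * (θ • ‖x‖⁻¹ • x) i = |τ| * w * x i := by
      simp only [PiLp.smul_apply, smul_eq_mul, hθ]
      field_simp
    rw [hval, hw, ← Real.cos_abs, ← Real.cos_abs (τ * x i * (z.1 - z.2))]
    simp only [abs_mul, abs_abs]
    ring_nf
  have hint : 4 * Real.posLog A ≤ ∫ z, F z ∂(μ.prod μ) := by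
    have hm := mul_meas_ge_le_integral_of_nonneg (μ := μ.prod μ)
      (Filter.Eventually.of_forall hF0) hFi (8 * (L ^ 2 * Real.posLog A))
    have hp : p₀ / 2 ≤ (μ.prod μ).real {z | 8 * (L ^ 2 * Real.posLog A) ≤ F z} :=
      (half_le_measureReal_symmetrization h1 h2).trans (measureReal_mono fun z hz => hlow z hz)
    refine le_trans ?_ hm
    have hl := Real.posLog_nonneg (x := A)
    calc 4 * Real.posLog A ≤ 4 * ((p₀ * L ^ 2) * Real.posLog A) := by
          gcongr; exact le_mul_of_one_le_left hl hLp
      _ = 8 * (L ^ 2 * Real.posLog A) * (p₀ / 2) := by ring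
      _ ≤ _ := by gcongr
  refine hprod.trans ((Real.exp_le_exp.2
    (by linarith : -(1 / 2) * ∫ z, F z ∂(μ.prod μ) ≤ -(2 * Real.posLog A))).trans ?_)
  have hAsq : (ε₀ * ‖x‖ / (2 * Real.pi * L) * τ) ^ 2 = A ^ 2 := by
    rw [← sq_abs, hA, abs_mul, abs_of_pos (by positivity)]
    ring
  rw [hAsq, Real.exp_neg, le_div_iff₀ (by positivity), inv_mul_le_iff₀ (Real.exp_pos _)]
  have hA1 : A ≤ Real.exp (Real.posLog A) := by
    rw [Real.posLog_apply]
    exact (Real.exp_log hA0).symm.le.trans (Real.exp_le_exp.2 (le_max_right _ _))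
  have h1e : 1 ≤ Real.exp (Real.posLog A) := Real.one_le_exp Real.posLog_nonneg
  rw [show 2 * Real.posLog A = Real.posLog A + Real.posLog A by ring, Real.exp_add]
  nlinarith

lemma gaussianReal_abs_ge_le {s : ℝ} (hs : 0 ≤ s) :
    (gaussianReal 0 1).real {g | s ≤ |g|} ≤ 2 * Real.exp (-s ^ 2 / 2) := by
  have hsub : HasSubgaussianMGF (fun g : ℝ => g) 1 (gaussianReal 0 1) := by
    refine ⟨fun t => integrable_exp_mul_gaussianReal t, fun t => ?_⟩
    have := mgf_gaussianReal (p := gaussianReal 0 1) (X := fun g : ℝ => g) (μ := 0) (v := 1)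
      (by simp) t
    rw [this]
    simp
  have h1 := hsub.measure_ge_le hs
  have h2 := hsub.neg.measure_ge_le hs
  have h3 : {g : ℝ | s ≤ |g|} ⊆ {g | s ≤ g} ∪ {g | s ≤ (-fun g : ℝ => g) g} := by
    intro g hg
    exact le_abs.1 (show s ≤ |g| from hg)
  have h4 := (measureReal_mono (μ := gaussianReal 0 1) h3).trans (measureReal_union_le _ _)
  simp only [NNReal.coe_one, mul_one] at h1 h2
  linarith

lemma integral_gaussianReal_cauchy_le {κ : ℝ} (hκ : 0 < κ) :
    ∫ g, 2 / (1 + (κ * g) ^ 2) ∂(gaussianReal 0 1) ≤ 4 / κ := by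
  rw [integral_gaussianReal_eq_integral_smul one_ne_zero]
  have hI : Integrable fun g : ℝ => 2 * (1 + (κ * g) ^ 2)⁻¹ :=
    ((integrable_inv_one_add_sq).comp_mul_left' hκ.ne').const_mul 2
  have hval : ∫ g : ℝ, 2 * (1 + (κ * g) ^ 2)⁻¹ = 2 * (κ⁻¹ * Real.pi) := by
    rw [integral_const_mul, Measure.integral_comp_mul_left (fun y => (1 + y ^ 2)⁻¹),
      integral_univ_inv_one_add_sq, abs_of_pos (inv_pos.2 hκ), smul_eq_mul]
  have hpdf : ∀ g, gaussianPDFReal 0 1 g ≤ 1 / 2 := fun g => by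
    have h1 : (2 : ℝ) ≤ √(2 * Real.pi * (1 : NNReal)) := by
      apply Real.le_sqrt_of_sq_le
      have := Real.pi_gt_three
      norm_num
      linarith
    rw [gaussianPDFReal]
    have h2 : Real.exp (-(g - 0) ^ 2 / (2 * (1 : NNReal))) ≤ 1 :=
      Real.exp_le_one_iff.2 (div_nonpos_of_nonpos_of_nonneg (by nlinarith [sq_nonneg (g - 0)])
        (by positivity))
    have h3 : (√(2 * Real.pi * (1 : NNReal)))⁻¹ ≤ 2⁻¹ := inv_anti₀ (by norm_num) h1
    nlinarith [Real.exp_pos (-(g - 0) ^ 2 / (2 * (1 : NNReal)))]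
  calc _ ≤ ∫ g : ℝ, 1 / 2 * (2 * (1 + (κ * g) ^ 2)⁻¹) := by
        refine integral_mono_of_nonneg (Filter.Eventually.of_forall fun g => ?_)
          (hI.const_mul _) (Filter.Eventually.of_forall fun g => ?_)
        · exact mul_nonneg (gaussianPDFReal_nonneg _ _ _) (by positivity)
        · simp only [smul_eq_mul, div_eq_mul_inv]
          have := hpdf g
          gcongr
          simpa using this
    _ = Real.pi / κ := by rw [integral_const_mul, hval]; ring
    _ ≤ 4 / κ := by gcongr; exact Real.pi_le_four

/-- The Gaussian average of the characteristic function of `∑ i, x i * ξ i` at scale `1 / t`. By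
Esseen's argument it bounds the probability that this sum lies in a given interval of length of
order `t`. -/
lemma integral_gaussianReal_prod_norm_charFun_le {μ : Measure ℝ} [IsProbabilityMeasure μ]
    {ε₀ p₀ K₀ L t D : ℝ}
    (h1 : (μ.prod μ).real {z : ℝ × ℝ | |z.1 - z.2| ≤ ε₀} ≤ 1 - p₀)
    (h2 : μ.real {x | K₀ < |x|} ≤ p₀ / 4) (hε₀ : 0 < ε₀) (hK₀ : 0 < K₀) (hL : 0 < L)
    (hLp : 1 ≤ p₀ * L ^ 2) (ht : 0 < t) (hD : 0 < D)
    {ι : Type*} [Fintype ι] {x : EuclideanSpace ℝ ι} (hx : 0 < ‖x‖) (hx1 : ‖x‖ ≤ 1)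
    (hlcd : D ≤ lcd L (‖x‖⁻¹ • x)) :
    ∫ g, ∏ i, ‖charFun μ (g / t * x i)‖ ∂(gaussianReal 0 1) ≤
      8 * Real.pi * L * t / (ε₀ * ‖x‖) + 2 * Real.exp (-(t * D / K₀) ^ 2 / 2) := by
  have hpi := Real.pi_pos
  set κ : ℝ := ε₀ * ‖x‖ / (2 * Real.pi * L) / t with hκ
  have hκ0 : 0 < κ := by positivity
  have hP1 : ∀ g : ℝ, ∏ i, ‖charFun μ (g / t * x i)‖ ≤ 1 := fun g =>
    Finset.prod_le_one (fun _ _ => norm_nonneg _) fun _ _ => norm_charFun_le_one _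
  have hS : MeasurableSet {g : ℝ | t * D / K₀ ≤ |g|} :=
    measurableSet_le measurable_const (by fun_prop)
  have hbound : ∀ g : ℝ, ∏ i, ‖charFun μ (g / t * x i)‖ ≤
      2 / (1 + (κ * g) ^ 2) + {g : ℝ | t * D / K₀ ≤ |g|}.indicator 1 g := by
    intro g
    by_cases hg : t * D / K₀ ≤ |g|
    · rw [Set.indicator_of_mem (show g ∈ {g : ℝ | t * D / K₀ ≤ |g|} from hg)]
      have : 0 ≤ 2 / (1 + (κ * g) ^ 2) := by positivity
      have := hP1 g
      simp only [Pi.one_apply]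
      linarith
    · rw [Set.indicator_of_notMem (show g ∉ {g : ℝ | t * D / K₀ ≤ |g|} from hg), add_zero]
      refine (prod_norm_charFun_le (τ := g / t) h1 h2 hε₀ hL hLp hx ?_).trans_eq ?_
      · refine lt_of_lt_of_le ?_ hlcd
        rw [not_le, lt_div_iff₀ hK₀] at hg
        rw [abs_div, abs_of_pos ht, div_lt_iff₀ hpi]
        have h3 : |g| / t * K₀ < D := by
          rw [div_mul_eq_mul_div, div_lt_iff₀ ht]; linarith
        have h4 : |g| / t * K₀ * ‖x‖ ≤ |g| / t * K₀ := mul_le_of_le_one_right (by positivity) hx1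
        nlinarith [Real.pi_gt_three]
      · rw [hκ]; congr 3; ring
  have hIc : Integrable (fun g : ℝ => 2 / (1 + (κ * g) ^ 2)) (gaussianReal 0 1) := by
    refine Integrable.of_bound
      (Measurable.aestronglyMeasurable (by fun_prop)) 2 (Filter.Eventually.of_forall fun g => ?_)
    rw [Real.norm_of_nonneg (by positivity)]
    exact div_le_self (by norm_num) (by nlinarith [sq_nonneg (κ * g)])
  have hIi : Integrable ({g : ℝ | t * D / K₀ ≤ |g|}.indicator (1 : ℝ → ℝ)) (gaussianReal 0 1) :=
    (integrable_const (1 : ℝ)).indicator hS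
  calc _ ≤ ∫ g, (2 / (1 + (κ * g) ^ 2) + {g : ℝ | t * D / K₀ ≤ |g|}.indicator 1 g)
        ∂(gaussianReal 0 1) :=
        integral_mono_of_nonneg (Filter.Eventually.of_forall fun g => by positivity)
          (hIc.add hIi) (Filter.Eventually.of_forall hbound)
    _ = ∫ g, 2 / (1 + (κ * g) ^ 2) ∂(gaussianReal 0 1) +
        (gaussianReal 0 1).real {g : ℝ | t * D / K₀ ≤ |g|} := by
        rw [integral_add hIc hIi, integral_indicator_one hS]
    _ ≤ 4 / κ + 2 * Real.exp (-(t * D / K₀) ^ 2 / 2) :=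
        add_le_add (integral_gaussianReal_cauchy_le hκ0) (gaussianReal_abs_ge_le (by positivity))
    _ = _ := by rw [hκ]; field_simp; ring

/-! ### Small ball probabilities for a shifted Wigner matrix -/

/-- A double sum over `Fin n`, folded onto the pairs on or above the diagonal. -/
lemma sum_sum_eq_sum_upper {n : ℕ} (f : Fin n → Fin n → ℝ) :
    ∑ i, ∑ j, f i j = ∑ p : {p : Fin n × Fin n // p.1 ≤ p.2},
      (f p.1.1 p.1.2 + if p.1.1 < p.1.2 then f p.1.2 p.1.1 else 0) := by
  have hsplit : ∀ p : Fin n × Fin n, f p.1 p.2 =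
      (if p.1 ≤ p.2 then f p.1 p.2 else 0) + if p.2 < p.1 then f p.1 p.2 else 0 := by
    intro p
    rcases le_or_gt p.1 p.2 with h | h
    · simp [h, not_lt.2 h]
    · simp [h, not_le.2 h]
  have hswap : ∑ p : Fin n × Fin n, (if p.2 < p.1 then f p.1 p.2 else 0) =
      ∑ p : Fin n × Fin n, if p.1 < p.2 then f p.2 p.1 else 0 :=
    Fintype.sum_equiv (Equiv.prodComm _ _) _ _ fun p => rfl
  rw [← Fintype.sum_prod_type' f, Finset.sum_congr rfl fun p _ => hsplit p,
    Finset.sum_add_distrib, hswap, ← Finset.sum_add_distrib]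
  have hsub := Finset.sum_subtype
    (F := inferInstanceAs (Fintype {p : Fin n × Fin n // p.1 ≤ p.2})) (Finset.univ.filter fun p : Fin n × Fin n => p.1 ≤ p.2)
    (p := fun p : Fin n × Fin n => p.1 ≤ p.2) (by simp)
    (fun p => f p.1 p.2 + if p.1 < p.2 then f p.2 p.1 else 0)
  rw [← hsub, Finset.sum_filter]
  refine Finset.sum_congr rfl fun p _ => ?_
  by_cases h : p.1 ≤ p.2
  · simp [h]
  · rw [if_neg h, if_neg h, if_neg fun h' => h h'.le, add_zero]

lemma prod_le_prod_of_injective {ι κ : Type*} [Fintype ι] [Fintype κ] {F : κ → ℝ}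
    (h0 : ∀ k, 0 ≤ F k) (h1 : ∀ k, F k ≤ 1) {e : ι → κ} (he : Function.Injective e) :
    ∏ k, F k ≤ ∏ i, F (e i) := by
  classical
  have : ∏ i, F (e i) = ∏ k ∈ Finset.univ.map ⟨e, he⟩, F k := by
    rw [Finset.prod_map]; rfl
  rw [this, ← Finset.prod_mul_prod_compl (Finset.univ.map ⟨e, he⟩) F]
  exact mul_le_of_le_one_right (Finset.prod_nonneg fun _ _ => h0 _)
    (Finset.prod_le_one (fun _ _ => h0 _) fun _ _ => h1 _)

section

variable {Ω Ω₀ : Type*} [MeasurableSpace Ω] [MeasurableSpace Ω₀] {P : Measure Ω}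
  {P₀ : Measure Ω₀} {ξ ζ : Ω₀ → ℝ} {n : ℕ} {W : Ω → Matrix (Fin n) (Fin n) ℝ}

/-- The characteristic function of a linear functional of the independent entries of a Wigner
matrix factorizes. Only the entries in the block `Iᶜ × I` are retained in the bound: for these, if
`a` vanishes on `I`, the coefficient of `w_ij` in `⟨a, W x⟩` is exactly `a_i x_j`. -/
lemma IsWigner.norm_integral_exp_le [IsProbabilityMeasure P] (hW : IsWigner P P₀ ξ ζ W)
    (a x : Fin n → ℝ) (c : ℝ) (I : Finset (Fin n)) (ha : ∀ i ∈ I, a i = 0) :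
    ‖∫ ω, Complex.exp ((∑ i, a i * (∑ j, W ω i j * x j) + c : ℝ) * Complex.I) ∂P‖ ≤
      ∏ i : (Iᶜ : Finset (Fin n)), ∏ j : I, ‖charFun (P₀.map ξ) (a i * x j)‖ := by
  classical
  set U := {p : Fin n × Fin n // p.1 ≤ p.2}
  set w : U → Ω → ℝ := fun p ω => W ω p.1.1 p.1.2 with hw
  have hwm : ∀ p, Measurable (w p) := fun p => hW.measurable_entry _ _
  set b : U → ℝ := fun p =>
    a p.1.1 * x p.1.2 + if p.1.1 < p.1.2 then a p.1.2 * x p.1.1 else 0 with hb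
  have hsum : ∀ ω, ∑ i, a i * (∑ j, W ω i j * x j) = ∑ p, b p * w p ω := by
    intro ω
    simp only [Finset.mul_sum]
    rw [sum_sum_eq_sum_upper]
    refine Finset.sum_congr rfl fun p _ => ?_
    have hs : W ω p.1.2 p.1.1 = W ω p.1.1 p.1.2 := (hW.isSymm ω).apply _ _
    simp only [hb, hw]
    split_ifs
    · rw [hs]; ring
    · ring
  set X : U → Ω → ℂ := fun p ω => Complex.exp (b p * w p ω * Complex.I) with hX
  have hXi : iIndepFun X P := hW.iIndep.comp (fun p (y : ℝ) => Complex.exp (b p * y * Complex.I))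
    fun p => by fun_prop
  have hXm : ∀ p, AEStronglyMeasurable (X p) P := fun p =>
    Measurable.aestronglyMeasurable (by have := hwm p; fun_prop)
  have hXc : ∀ p, ∫ ω, X p ω ∂P = charFun (P.map (w p)) (b p) := by
    intro p
    rw [charFun_apply_real, integral_map (hwm p).aemeasurable (by fun_prop)]
  have hfac : ∫ ω, Complex.exp ((∑ i, a i * (∑ j, W ω i j * x j) + c : ℝ) * Complex.I) ∂P =
      Complex.exp (c * Complex.I) * ∏ p, charFun (P.map (w p)) (b p) := by
    rw [← Finset.prod_congr rfl fun p _ => hXc p, ← hXi.integral_prod_eq_prod_integral hXm,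
      ← integral_const_mul]
    congr 1 with ω
    rw [Finset.prod_apply, hX, ← Complex.exp_sum, ← Complex.exp_add, hsum ω]
    congr 1
    push_cast
    rw [add_mul, Finset.sum_mul, add_comm]
  rw [hfac, norm_mul, Complex.norm_exp_ofReal_mul_I, one_mul, norm_prod]
  have hprob : ∀ p, IsProbabilityMeasure (P.map (w p)) := fun p =>
    Measure.isProbabilityMeasure_map (hwm p).aemeasurable
  have hne : ∀ q : (Iᶜ : Finset (Fin n)) × I, q.1.1 ≠ q.2.1 := fun q h =>
    Finset.mem_compl.1 q.1.2 (h ▸ q.2.2)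
  set e : (Iᶜ : Finset (Fin n)) × I → U := fun q =>
    ⟨(min q.1.1 q.2.1, max q.1.1 q.2.1), min_le_max⟩ with he
  have hinj : Function.Injective e := by
    intro q r h
    have h1 := congrArg (fun p : U => p.1.1) h
    have h2 := congrArg (fun p : U => p.1.2) h
    simp only [he] at h1 h2
    have hq1 := Finset.mem_compl.1 q.1.2
    have hr1 := Finset.mem_compl.1 r.1.2
    have hq2 := q.2.2
    have hr2 := r.2.2
    have : q.1.1 = r.1.1 ∧ q.2.1 = r.2.1 := by
      rcases le_total q.1.1 q.2.1 with hq | hq <;> rcases le_total r.1.1 r.2.1 with hr | hr <;>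
        simp only [min_eq_left hq, max_eq_right hq, min_eq_right hq, max_eq_left hq,
          min_eq_left hr, max_eq_right hr, min_eq_right hr, max_eq_left hr] at h1 h2
      · exact ⟨h1, h2⟩
      · rw [h1] at hq1; exact absurd hr2 hq1
      · rw [h2] at hq1; exact absurd hr2 hq1
      · exact ⟨h2, h1⟩
    exact Prod.ext (Subtype.ext this.1) (Subtype.ext this.2)
  refine (prod_le_prod_of_injective (fun p => norm_nonneg _)
    (fun p => norm_charFun_le_one _) hinj).trans_eq ?_
  rw [Fintype.prod_prod_type]
  refine Finset.prod_congr rfl fun i _ => Finset.prod_congr rfl fun j _ => ?_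
  have hij : i.1 ≠ j.1 := hne (i, j)
  have hbij : b (e (i, j)) = a i * x j := by
    simp only [hb, he]
    rcases lt_or_gt_of_ne hij with h | h
    · simp [min_eq_left h.le, max_eq_right h.le, ha j.1 j.2]
    · simp [min_eq_right h.le, max_eq_left h.le, ha j.1 j.2, h]
  have hlt : (e (i, j)).1.1 < (e (i, j)).1.2 := min_lt_max.2 hij
  rw [hbij, (hW.upper _ _ hlt).map_eq]

/-- `exp (-|u|² / 2)` as a Gaussian average of characters. -/
lemma exp_neg_sum_sq_eq_integral {ι : Type*} [Fintype ι] (u : ι → ℝ) :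
    (Real.exp (-(∑ i, u i ^ 2) / 2) : ℂ) =
      ∫ G, Complex.exp ((∑ i, G i * u i : ℝ) * Complex.I)
        ∂(Measure.pi fun _ : ι => gaussianReal 0 1) := by
  have h : ∀ v : ℝ, ∫ g, Complex.exp (v * g * Complex.I) ∂(gaussianReal 0 1) =
      Complex.exp (-v ^ 2 / 2) := by
    intro v
    rw [← charFun_apply_real, charFun_gaussianReal]
    congr 1
    simp
    ring
  have h2 : (Real.exp (-(∑ i, u i ^ 2) / 2) : ℂ) = ∏ i, Complex.exp (-(u i : ℂ) ^ 2 / 2) := by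
    rw [← Complex.exp_sum, Complex.ofReal_exp]
    congr 1
    push_cast
    rw [← Finset.sum_div, Finset.sum_neg_distrib]
  rw [h2, ← Finset.prod_congr rfl fun i _ => h (u i),
    ← integral_fintype_prod_eq_prod (fun i (g : ℝ) => Complex.exp (u i * g * Complex.I))]
  congr 1 with G
  rw [← Complex.exp_sum]
  congr 1
  push_cast
  rw [Finset.sum_mul]
  exact Finset.sum_congr rfl fun i _ => by ring

/-- Small ball estimate for `(W - μ) x`: by Markov's inequality the probability is controlled by the
expectation of a Gaussian function of the coordinates outside `I`, which is a Gaussian average of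
characteristic functions. The entries of the block `Iᶜ × I` make it factorize over the rows, so no
conditioning on the remaining entries is needed. -/
lemma IsWigner.measureReal_norm_sub_le [IsProbabilityMeasure P] [IsProbabilityMeasure P₀]
    (hW : IsWigner P P₀ ξ ζ W) (hξ : Measurable ξ)
    (x : EuclideanSpace ℝ (Fin n)) (I : Finset (Fin n)) (μ : ℝ) {t : ℝ} (ht : 0 < t) :
    P.real {ω | ‖Matrix.toEuclideanLin (W ω) x - μ • x‖ ≤ t * √n} ≤
      Real.exp (n / 2) * (∫ g, ∏ j : I, ‖charFun (P₀.map ξ) (g / t * restrict x I j)‖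
        ∂(gaussianReal 0 1)) ^ (n - I.card) := by
  classical
  have hWm := hW.measurable_entry
  have hprob : IsProbabilityMeasure (P₀.map ξ) :=
    Measure.isProbabilityMeasure_map hξ.aemeasurable
  set y : Ω → Fin n → ℝ := fun ω i => ∑ j, W ω i j * x j - μ * x i with hy
  have hyn : ∀ ω i, (Matrix.toEuclideanLin (W ω) x - μ • x) i = y ω i := by
    intro ω i
    simp [hy, Matrix.mulVec, dotProduct]
  set u : Ω → Fin n → ℝ := fun ω i => if i ∈ I then 0 else y ω i / t with hu
  have hym : ∀ i, Measurable fun ω => y ω i := fun i => by fun_prop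
  have hum : ∀ i, Measurable fun ω => u ω i := fun i => by
    by_cases hi : i ∈ I
    · simp [hu, hi]
    · simp only [hu, hi, if_false]
      have := hym i
      fun_prop
  set Ψ : Ω → ℝ := fun ω => Real.exp (-(∑ i, u ω i ^ 2) / 2) with hΨ
  have hΨm : Measurable Ψ := by fun_prop
  have hΨi : Integrable Ψ P := by
    refine Integrable.of_bound hΨm.aestronglyMeasurable 1 (Filter.Eventually.of_forall fun ω => ?_)
    rw [Real.norm_of_nonneg (Real.exp_nonneg _)]
    exact Real.exp_le_one_iff.2 (div_nonpos_of_nonpos_of_nonneg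
      (neg_nonpos.2 (Finset.sum_nonneg fun i _ => sq_nonneg _)) (by norm_num))
  have hsub : {ω | ‖Matrix.toEuclideanLin (W ω) x - μ • x‖ ≤ t * √n} ⊆
      {ω | Real.exp (-(n / 2 : ℝ)) ≤ Ψ ω} := by
    intro ω hω
    have hω' : ‖Matrix.toEuclideanLin (W ω) x - μ • x‖ ≤ t * √n := hω
    have h2 := pow_le_pow_left₀ (norm_nonneg _) hω' 2
    rw [EuclideanSpace.norm_sq_eq, mul_pow, Real.sq_sqrt (Nat.cast_nonneg _)] at h2
    simp only [hyn, Real.norm_eq_abs, sq_abs] at h2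
    refine Real.exp_le_exp.2 ?_
    have h3 : ∑ i, u ω i ^ 2 ≤ n := by
      calc ∑ i, u ω i ^ 2 ≤ ∑ i, y ω i ^ 2 / t ^ 2 := Finset.sum_le_sum fun i _ => by
            simp only [hu]
            split_ifs
            · simp; positivity
            · rw [div_pow]
        _ = (∑ i, y ω i ^ 2) / t ^ 2 := by rw [Finset.sum_div]
        _ ≤ n := by rw [div_le_iff₀ (by positivity)]; linarith
    linarith
  have hmark := mul_meas_ge_le_integral_of_nonneg (μ := P)
    (Filter.Eventually.of_forall fun ω => (Real.exp_pos _).le) hΨi (Real.exp (-(n / 2 : ℝ)))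
  have hmono := measureReal_mono (μ := P) hsub
  have hfirst : P.real {ω | ‖Matrix.toEuclideanLin (W ω) x - μ • x‖ ≤ t * √n} ≤
      Real.exp (n / 2) * ∫ ω, Ψ ω ∂P := by
    refine hmono.trans ?_
    have hinv : Real.exp (n / 2) * Real.exp (-(n / 2 : ℝ)) = 1 := by
      rw [← Real.exp_add]; simp
    calc P.real {ω | Real.exp (-(n / 2 : ℝ)) ≤ Ψ ω} = Real.exp (n / 2) *
          (Real.exp (-(n / 2 : ℝ)) * P.real {ω | Real.exp (-(n / 2 : ℝ)) ≤ Ψ ω}) := by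
          rw [← mul_assoc, hinv, one_mul]
      _ ≤ _ := mul_le_mul_of_nonneg_left hmark (Real.exp_nonneg _)
  refine hfirst.trans (mul_le_mul_of_nonneg_left ?_ (Real.exp_nonneg _))
  set N : Measure (Fin n → ℝ) := Measure.pi fun _ : Fin n => gaussianReal 0 1 with hN
  have hint : Integrable (Function.uncurry fun (ω : Ω) (G : Fin n → ℝ) =>
      Complex.exp ((∑ i, G i * u ω i : ℝ) * Complex.I)) (P.prod N) := by
    refine Integrable.of_bound (Measurable.aestronglyMeasurable ?_) 1
      (Filter.Eventually.of_forall fun z => ?_)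
    · change Measurable fun z : Ω × (Fin n → ℝ) =>
        Complex.exp ((∑ i, z.2 i * u z.1 i : ℝ) * Complex.I)
      have : ∀ i, Measurable fun z : Ω × (Fin n → ℝ) => u z.1 i := fun i =>
        (hum i).comp measurable_fst
      fun_prop
    · exact (Complex.norm_exp_ofReal_mul_I _).le
  set h : Fin n → ℝ → ℝ := fun i g =>
    if i ∈ I then 1 else ∏ j : I, ‖charFun (P₀.map ξ) (g / t * restrict x I j)‖ with hh
  have hhm : ∀ i, Measurable (h i) := fun i => by
    have hc : Measurable (charFun (P₀.map ξ)) := continuous_charFun.measurable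
    by_cases hi : i ∈ I
    · simp only [hh, hi, if_true]; fun_prop
    · simp only [hh, hi, if_false]; fun_prop
  have hh0 : ∀ i g, 0 ≤ h i g := fun i g => by
    simp only [hh]; split_ifs <;> positivity
  have hh1 : ∀ i g, h i g ≤ 1 := fun i g => by
    simp only [hh]
    split_ifs
    · exact le_rfl
    · exact Finset.prod_le_one (fun _ _ => norm_nonneg _) fun _ _ => norm_charFun_le_one _
  have hhi : Integrable (fun G : Fin n → ℝ => ∏ i, h i (G i)) N := by
    refine Integrable.of_bound (Measurable.aestronglyMeasurable (by fun_prop)) 1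
      (Filter.Eventually.of_forall fun G => ?_)
    rw [Real.norm_of_nonneg (Finset.prod_nonneg fun i _ => hh0 _ _)]
    exact Finset.prod_le_one (fun i _ => hh0 _ _) fun i _ => hh1 _ _
  have hrow : ∀ G : Fin n → ℝ,
      ‖∫ ω, Complex.exp ((∑ i, G i * u ω i : ℝ) * Complex.I) ∂P‖ ≤ ∏ i, h i (G i) := by
    intro G
    set a : Fin n → ℝ := fun i => if i ∈ I then 0 else G i / t with hadef
    have e1 : ∀ ω, ∑ i, G i * u ω i =
        ∑ i, a i * (∑ j, W ω i j * x j) + -∑ i, a i * (μ * x i) := by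
      intro ω
      rw [← sub_eq_add_neg, ← Finset.sum_sub_distrib]
      refine Finset.sum_congr rfl fun i _ => ?_
      simp only [hu, hadef, hy]
      split_ifs
      · simp
      · ring
    simp only [e1]
    refine (hW.norm_integral_exp_le a x _ I fun i hi => by simp [hadef, hi]).trans_eq ?_
    rw [← Finset.prod_mul_prod_compl I fun i => h i (G i),
      Finset.prod_congr rfl fun i hi => (by simp [hh, hi] : h i (G i) = 1),
      Finset.prod_const_one, one_mul, ← Finset.prod_coe_sort Iᶜ]
    refine Finset.prod_congr rfl fun i _ => ?_
    have hi := Finset.mem_compl.1 i.2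
    simp only [hh, hadef, hi, if_false]
    rfl
  have hcomplex : ((∫ ω, Ψ ω ∂P : ℝ) : ℂ) =
      ∫ G, ∫ ω, Complex.exp ((∑ i, G i * u ω i : ℝ) * Complex.I) ∂P ∂N := by
    rw [← integral_integral_swap hint, ← integral_complex_ofReal]
    congr 1 with ω
    exact exp_neg_sum_sq_eq_integral (u ω)
  have hpos : 0 ≤ ∫ ω, Ψ ω ∂P := integral_nonneg fun ω => (Real.exp_pos _).le
  calc ∫ ω, Ψ ω ∂P = ‖((∫ ω, Ψ ω ∂P : ℝ) : ℂ)‖ := by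
        rw [Complex.norm_real, Real.norm_of_nonneg hpos]
    _ ≤ ∫ G, ‖∫ ω, Complex.exp ((∑ i, G i * u ω i : ℝ) * Complex.I) ∂P‖ ∂N := by
        rw [hcomplex]; exact norm_integral_le_integral_norm _
    _ ≤ ∫ G, ∏ i, h i (G i) ∂N :=
        integral_mono_of_nonneg (Filter.Eventually.of_forall fun G => norm_nonneg _) hhi
          (Filter.Eventually.of_forall hrow)
    _ = ∏ i, ∫ g, h i g ∂(gaussianReal 0 1) := integral_fintype_prod_eq_prod h
    _ = _ := by
        rw [← Finset.prod_mul_prod_compl I,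
          Finset.prod_congr rfl fun i hi =>
            (by simp [hh, hi] : ∫ g, h i g ∂(gaussianReal 0 1) = 1),
          Finset.prod_const_one, one_mul, Finset.prod_congr rfl fun i hi =>
            (by simp [hh, Finset.mem_compl.1 hi] : ∫ g, h i g ∂(gaussianReal 0 1) =
              ∫ g, ∏ j : I, ‖charFun (P₀.map ξ) (g / t * restrict x I j)‖ ∂(gaussianReal 0 1)),
          Finset.prod_const, Finset.card_compl, Fintype.card_fin]

end

/-! ### Counting lattice points -/

lemma sum_exp_neg_mul_abs_le {l : ℝ} (hl : 0 < l) (s : Finset ℤ) :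
    ∑ k ∈ s, Real.exp (-(l * |(k : ℝ)|)) ≤ 2 * (1 + 1 / l) := by
  set r := Real.exp (-l) with hr
  have hr0 : 0 < r := Real.exp_pos _
  have hr1 : r < 1 := Real.exp_zero ▸ Real.exp_lt_exp.2 (by linarith)
  have hpow : ∀ m : ℕ, Real.exp (-(l * m)) = r ^ m := fun m => by
    rw [hr, ← Real.exp_nat_mul]; congr 1; ring
  have h1 : HasSum (fun m : ℕ => Real.exp (-(l * |((m : ℤ) : ℝ)|))) (1 - r)⁻¹ := by
    simp only [Int.cast_natCast, Nat.abs_cast, hpow]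
    exact hasSum_geometric_of_lt_one hr0.le hr1
  have h2 : HasSum (fun m : ℕ => Real.exp (-(l * |((-(m + 1 : ℤ) : ℤ) : ℝ)|)))
      (r * (1 - r)⁻¹) := by
    have : ∀ m : ℕ, Real.exp (-(l * |((-(m + 1 : ℤ) : ℤ) : ℝ)|)) = r * r ^ m := fun m => by
      rw [← pow_succ', ← hpow]
      push_cast
      rw [abs_neg, abs_of_nonneg (by positivity)]
    simp only [this]
    exact (hasSum_geometric_of_lt_one hr0.le hr1).mul_left r
  have h3 := HasSum.of_nat_of_neg_add_one (f := fun k : ℤ => Real.exp (-(l * |(k : ℝ)|))) h1 h2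
  refine (sum_le_hasSum s (fun k _ => (Real.exp_pos _).le) h3).trans ?_
  have h4 : (1 - r)⁻¹ ≤ 1 + 1 / l := by
    have h5 : r * (1 + l) ≤ 1 := by
      have := Real.add_one_le_exp l
      calc r * (1 + l) ≤ r * Real.exp l := by gcongr; linarith
        _ = 1 := by rw [hr, ← Real.exp_add]; simp
    rw [inv_le_iff_one_le_mul₀ (by linarith)]
    have : (1 + 1 / l) * (1 - r) = (1 + l) * (1 - r) / l := by field_simp; ring
    rw [this, le_div_iff₀ hl]
    linarith
  have h6 : 0 < (1 - r)⁻¹ := inv_pos.2 (by linarith)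
  nlinarith

/-- The number of lattice points in a weighted `ℓ¹` ball, bounded by exponential weights. -/
lemma exists_finset_card_le {ι : Type*} [Fintype ι] (l : ι → ℝ) (hl : ∀ i, 0 < l i) (S : ℝ) :
    ∃ T : Finset (ι → ℤ), (∀ p : ι → ℤ, ∑ i, l i * |(p i : ℝ)| ≤ S → p ∈ T) ∧
      (T.card : ℝ) ≤ Real.exp S * ∏ i, (2 * (1 + 1 / l i)) := by
  classical
  set B : Finset (ι → ℤ) := Fintype.piFinset fun i => Finset.Icc (-⌈S / l i⌉) ⌈S / l i⌉ with hB
  refine ⟨B.filter fun p => ∑ i, l i * |(p i : ℝ)| ≤ S, fun p hp => ?_, ?_⟩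
  · rw [Finset.mem_filter, hB, Fintype.mem_piFinset]
    refine ⟨fun i => ?_, hp⟩
    have h1 : l i * |(p i : ℝ)| ≤ S :=
      (Finset.single_le_sum (f := fun i => l i * |(p i : ℝ)|)
        (fun j _ => mul_nonneg (hl j).le (abs_nonneg _)) (Finset.mem_univ i)).trans hp
    have h2 : |(p i : ℝ)| ≤ S / l i := by rw [le_div_iff₀ (hl i)]; linarith
    have h3 : |p i| ≤ ⌈S / l i⌉ := by
      have : ((|p i| : ℤ) : ℝ) ≤ (⌈S / l i⌉ : ℤ) := by
        push_cast; exact h2.trans (Int.le_ceil _)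
      exact_mod_cast this
    exact Finset.mem_Icc.2 (abs_le.1 h3)
  · rw [Finset.card_eq_sum_ones]
    push_cast
    calc ∑ p ∈ B.filter (fun p => ∑ i, l i * |(p i : ℝ)| ≤ S), (1 : ℝ)
        ≤ ∑ p ∈ B.filter (fun p => ∑ i, l i * |(p i : ℝ)| ≤ S),
          Real.exp S * ∏ i, Real.exp (-(l i * |(p i : ℝ)|)) := by
          refine Finset.sum_le_sum fun p hp => ?_
          have hp' := (Finset.mem_filter.1 hp).2
          rw [← Real.exp_sum, ← Real.exp_add, Finset.sum_neg_distrib]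
          exact Real.one_le_exp (by linarith)
      _ ≤ ∑ p ∈ B, Real.exp S * ∏ i, Real.exp (-(l i * |(p i : ℝ)|)) :=
          Finset.sum_le_sum_of_subset_of_nonneg (Finset.filter_subset _ _)
            fun p _ _ => by positivity
      _ = Real.exp S * ∏ i, ∑ k ∈ Finset.Icc (-⌈S / l i⌉) ⌈S / l i⌉,
            Real.exp (-(l i * |(k : ℝ)|)) := by
          rw [← Finset.mul_sum, Finset.prod_univ_sum]
      _ ≤ _ := by
          refine mul_le_mul_of_nonneg_left (Finset.prod_le_prod (fun i _ => ?_) fun i _ =>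
            sum_exp_neg_mul_abs_le (hl i) _) (Real.exp_nonneg _)
          exact Finset.sum_nonneg fun k _ => (Real.exp_pos _).le

/-! ### Encoding vectors by lattice points -/

/-- `(χ, a, p, q)` is a code of the vector `v` at resolution `1 / D`. The coordinates are coloured
by `χ`. The vector is dilated by a factor `s c ≥ 1` on the colour class `c`, and `a c` records this
factor up to `1 / D`. On each class, `q` records the difference between the dilated vector and the
lattice vector `p`, rounded to a grid whose step is proportional to the dilation. -/
def HasCode {n k : ℕ} (D : ℕ) (v : EuclideanSpace ℝ (Fin n))
    (κ : (Fin n → Fin (k + 1)) × (Fin (k + 1) → ℕ) × (Fin n → ℤ) × (Fin n → ℤ)) : Prop :=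
  ∃ s : Fin (k + 1) → ℝ, (∀ c, 1 ≤ s c) ∧ (∀ c, ⌊s c * D⌋₊ = κ.2.1 c) ∧
    ∀ i, κ.2.2.2 i =
      ⌊(s (κ.1 i) * v i - κ.2.2.1 i) / (κ.2.1 (κ.1 i) / ((D : ℝ) ^ 2 * √n))⌋

lemma abs_sub_le_of_floor_eq {D N s s' u u' p : ℝ} {a : ℕ} {q : ℤ} (hD : 1 ≤ D) (hN : 0 < N)
    (hs : 1 ≤ s) (hs' : 1 ≤ s') (ha : ⌊s * D⌋₊ = a) (ha' : ⌊s' * D⌋₊ = a)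
    (hq : q = ⌊(s * u - p) / (a / (D ^ 2 * N))⌋) (hq' : q = ⌊(s' * u' - p) / (a / (D ^ 2 * N))⌋) :
    |u - u'| ≤ (1 / N + |u'|) / D := by
  have hD0 : 0 < D := by linarith
  have hsD : 1 ≤ s * D := by nlinarith
  have hsD' : 1 ≤ s' * D := by nlinarith
  have ha1 : (1 : ℝ) ≤ a := by
    have : 1 ≤ ⌊s * D⌋₊ := Nat.le_floor (by simpa using hsD)
    rw [ha] at this
    exact_mod_cast this
  set h : ℝ := a / (D ^ 2 * N) with hh
  have hh0 : 0 < h := by positivity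
  have has : (a : ℝ) ≤ s * D := ha ▸ Nat.floor_le (by linarith)
  have has' : (a : ℝ) ≤ s' * D := ha' ▸ Nat.floor_le (by linarith)
  have hsa : s * D < a + 1 := ha ▸ Nat.lt_floor_add_one _
  have hsa' : s' * D < a + 1 := ha' ▸ Nat.lt_floor_add_one _
  have h1 : |s' - s| ≤ 1 / D := by
    rw [abs_le, ← neg_div, div_le_iff₀ hD0, le_div_iff₀ hD0]
    constructor <;> linarith
  have h2 : |s * u - s' * u'| ≤ h := by
    have := Int.abs_sub_lt_one_of_floor_eq_floor (hq.symm.trans hq')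
    rw [← sub_div, abs_div, abs_of_pos hh0, div_lt_one hh0] at this
    refine le_of_eq_of_le ?_ this.le
    congr 1
    ring
  have h3 : h ≤ s / (D * N) := by
    rw [hh, div_le_div_iff₀ (by positivity) (by positivity)]
    have : (a : ℝ) * (D * N) ≤ s * D * (D * N) := by gcongr
    nlinarith
  have h4 : s * |u - u'| ≤ s * ((1 / N + |u'|) / D) := by
    calc s * |u - u'| = |(s * u - s' * u') + (s' - s) * u'| := by
          rw [← abs_of_pos (by linarith : 0 < s), ← abs_mul, abs_of_pos (by linarith : 0 < s)]
          congr 1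
          ring
      _ ≤ |s * u - s' * u'| + |s' - s| * |u'| := by
          rw [← abs_mul]; exact abs_add_le _ _
      _ ≤ s / (D * N) + 1 / D * |u'| := by gcongr; exact h2.trans h3
      _ ≤ s / (D * N) + s * (1 / D * |u'|) := by
          exact add_le_add le_rfl (le_mul_of_one_le_left (by positivity) hs)
      _ = s * ((1 / N + |u'|) / D) := by field_simp
  exact le_of_mul_le_mul_left h4 (by linarith)

lemma HasCode.norm_sub_le {n k D : ℕ} {v v' : EuclideanSpace ℝ (Fin n)}
    {κ : (Fin n → Fin (k + 1)) × (Fin (k + 1) → ℕ) × (Fin n → ℤ) × (Fin n → ℤ)}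
    (hn : 0 < n) (hD : 1 ≤ D) (h : HasCode D v κ) (h' : HasCode D v' κ) (hv' : ‖v'‖ = 1) :
    ‖v - v'‖ ≤ 2 / D := by
  obtain ⟨s, hs1, hsa, hsq⟩ := h
  obtain ⟨s', hs1', hsa', hsq'⟩ := h'
  have hn0 : (0 : ℝ) < n := by exact_mod_cast hn
  have hD1 : (1 : ℝ) ≤ D := by exact_mod_cast hD
  have hc : ∀ i, |v i - v' i| ≤ (1 / √n + |v' i|) / D := fun i =>
    abs_sub_le_of_floor_eq hD1 (Real.sqrt_pos.2 hn0) (hs1 _) (hs1' _) (hsa _) (hsa' _) (hsq i)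
      (hsq' i)
  have hsum : ∑ i, v' i ^ 2 = 1 := by
    have := EuclideanSpace.norm_sq_eq v'
    rw [hv'] at this
    simpa using this.symm
  refine le_of_sq_le_sq ?_ (by positivity)
  rw [EuclideanSpace.norm_sq_eq]
  calc ∑ i, ‖(v - v') i‖ ^ 2 ≤ ∑ i, (2 * (1 / n) + 2 * v' i ^ 2) / (D : ℝ) ^ 2 := by
        refine Finset.sum_le_sum fun i _ => ?_
        have h1 := pow_le_pow_left₀ (abs_nonneg _) (hc i) 2
        rw [PiLp.sub_apply, Real.norm_eq_abs]
        refine h1.trans ?_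
        rw [div_pow]
        gcongr
        have h2 : (1 / √(n : ℝ)) ^ 2 = 1 / n := by
          rw [div_pow, Real.sq_sqrt hn0.le, one_pow]
        rw [← h2, ← sq_abs (v' i)]
        nlinarith [sq_nonneg (1 / √(n : ℝ) - |v' i|)]
    _ = (2 / (D : ℝ)) ^ 2 := by
        rw [← Finset.sum_div, Finset.sum_add_distrib, ← Finset.mul_sum, ← Finset.mul_sum, hsum]
        simp only [Finset.sum_const, Finset.card_univ, Fintype.card_fin, nsmul_eq_mul]
        field_simp
        norm_num

/-- A set of unit vectors that is encoded by `N` codes has a net of cardinality at most `N` inside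
itself. -/
lemma exists_net_of_hasCode {n k D : ℕ} (hn : 0 < n) (hD : 1 ≤ D)
    (T : Finset ((Fin n → Fin (k + 1)) × (Fin (k + 1) → ℕ) × (Fin n → ℤ) × (Fin n → ℤ)))
    (S : Set (EuclideanSpace ℝ (Fin n))) (hS : ∀ v ∈ S, ‖v‖ = 1)
    (hT : ∀ v ∈ S, ∃ κ ∈ T, HasCode D v κ) :
    ∃ R : Finset (EuclideanSpace ℝ (Fin n)), (↑R ⊆ S) ∧ R.card ≤ T.card ∧
      ∀ v ∈ S, ∃ x ∈ R, ‖v - x‖ ≤ 2 / D := by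
  classical
  have hch : ∀ κ : (Fin n → Fin (k + 1)) × (Fin (k + 1) → ℕ) × (Fin n → ℤ) × (Fin n → ℤ),
      ∃ x : EuclideanSpace ℝ (Fin n),
      (∃ v ∈ S, HasCode D v κ) → x ∈ S ∧ HasCode D x κ := by
    intro κ
    by_cases h : ∃ v ∈ S, HasCode D v κ
    · obtain ⟨v, hv⟩ := h
      exact ⟨v, fun _ => hv⟩
    · exact ⟨0, fun h' => absurd h' h⟩
  choose f hf using hch
  refine ⟨(T.filter fun κ => ∃ v ∈ S, HasCode D v κ).image f, ?_,
    Finset.card_image_le.trans (Finset.card_filter_le _ _), ?_⟩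
  · intro x hx
    obtain ⟨κ, hκ, rfl⟩ := Finset.mem_image.1 (Finset.mem_coe.1 hx)
    exact (hf κ (Finset.mem_filter.1 hκ).2).1
  · intro v hv
    obtain ⟨κ, hκT, hκ⟩ := hT v hv
    have hex : ∃ v ∈ S, HasCode D v κ := ⟨v, hv, hκ⟩
    exact ⟨f κ, Finset.mem_image_of_mem _ (Finset.mem_filter.2 ⟨hκT, hex⟩),
      hκ.norm_sub_le hn hD (hf κ hex).2 (hS _ (hf κ hex).1)⟩

lemma sum_abs_le_sqrt_mul {n : ℕ} (I : Finset (Fin n)) (u : Fin n → ℝ) {r : ℝ} (hr : 0 ≤ r)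
    (h : ∑ i ∈ I, u i ^ 2 ≤ r ^ 2) : ∑ i ∈ I, |u i| ≤ √n * r := by
  refine le_of_sq_le_sq ?_ (by positivity)
  rw [mul_pow, Real.sq_sqrt (Nat.cast_nonneg _)]
  refine sq_sum_le_card_mul_sum_sq.trans ?_
  simp only [sq_abs]
  have : (I.card : ℝ) ≤ n := by
    have := Finset.card_le_univ I
    rw [Fintype.card_fin] at this
    exact_mod_cast this
  have h0 : 0 ≤ ∑ i ∈ I, u i ^ 2 := Finset.sum_nonneg fun i _ => sq_nonneg _
  gcongr

/-- The number of pairs of lattice vectors in a code with given colouring `χ` and dilations `a`.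
Each coordinate of colour `0` contributes the trivial count `D`, and each coordinate of a nonzero
colour gains a factor `1 / √n`, up to powers of `z`. -/
lemma exists_finset_pairs {n k D m₁ : ℕ} {z : ℝ} (hn : 0 < n) (hD : 1 ≤ D) (hz : 6 ≤ z)
    (χ : Fin n → Fin (k + 1)) (a : Fin (k + 1) → ℕ)
    (hχ : m₁ ≤ (Finset.univ.filter fun i => χ i ≠ 0).card) (ha0 : a 0 = D)
    (ha : ∀ c, c ≠ 0 → √n * D ≤ z * a c) (ha1 : ∀ c, 1 ≤ a c)
    (ha2 : ∀ c, (a c : ℝ) ≤ z * (D : ℝ) ^ 2) :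
    ∃ T : Finset ((Fin n → ℤ) × (Fin n → ℤ)),
      (T.card : ℝ) ≤ Real.exp (2 * (k + 1) * n) * (z ^ 7 * D) ^ n * (1 / √n) ^ m₁ ∧
      ∀ p q : Fin n → ℤ, (∀ i, χ i = 0 → p i = 0) →
        (∀ c, c ≠ 0 → ∑ i with χ i = c, |(p i : ℝ)| ≤ √n * (2 * z ^ 3 * a c / D)) →
        (∀ c, ∑ i with χ i = c, |(q i : ℝ)| ≤ n * (2 * z ^ 2 * (D : ℝ) ^ 2 / a c)) →
        (p, q) ∈ T := by
  classical
  have hn0 : (0 : ℝ) < n := by exact_mod_cast hn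
  have hN : 0 < √(n : ℝ) := Real.sqrt_pos.2 hn0
  have hN1 : 1 ≤ √(n : ℝ) := Real.one_le_sqrt.2 (by exact_mod_cast hn)
  have hNN : √(n : ℝ) * √n = n := Real.mul_self_sqrt hn0.le
  have hD1 : (1 : ℝ) ≤ D := by exact_mod_cast hD
  have hz0 : 0 < z := by linarith
  have haR : ∀ c, (1 : ℝ) ≤ a c := fun c => by exact_mod_cast ha1 c
  have ha0' : ∀ c, (0 : ℝ) < a c := fun c => by linarith [haR c]
  set l : Fin (k + 1) → ℝ := fun c => if c = 0 then 1 else √n * D / (2 * z ^ 3 * a c) with hl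
  set m : Fin (k + 1) → ℝ := fun c => a c / (2 * z ^ 2 * (D : ℝ) ^ 2) with hm
  have hl0 : ∀ c, 0 < l c := fun c => by
    simp only [hl]
    have := ha0' c
    split_ifs <;> positivity
  have hm0 : ∀ c, 0 < m c := fun c => by
    have := ha0' c
    simp only [hm]; positivity
  obtain ⟨T₁, hT₁, hc₁⟩ := exists_finset_card_le (fun i => l (χ i)) (fun i => hl0 _)
    (((k + 1 : ℕ) : ℝ) * n)
  obtain ⟨T₂, hT₂, hc₂⟩ := exists_finset_card_le (fun i => m (χ i)) (fun i => hm0 _)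
    (((k + 1 : ℕ) : ℝ) * n)
  -- the weighted norm, computed colour by colour
  have hfib : ∀ (w : Fin (k + 1) → ℝ) (r : Fin n → ℤ),
      (∀ c, w c * ∑ i with χ i = c, |(r i : ℝ)| ≤ n) →
      ∑ i, w (χ i) * |(r i : ℝ)| ≤ ((k + 1 : ℕ) : ℝ) * n := by
    intro w r h
    rw [← Finset.sum_fiberwise Finset.univ χ]
    calc _ ≤ ∑ _c : Fin (k + 1), (n : ℝ) := Finset.sum_le_sum fun c _ => by
          refine le_trans (le_of_eq ?_) (h c)
          rw [Finset.mul_sum]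
          refine Finset.sum_congr rfl fun i hi => ?_
          rw [(Finset.mem_filter.1 hi).2]
      _ = _ := by simp
  refine ⟨T₁ ×ˢ T₂, ?_, fun p q hp0 hp hq => Finset.mem_product.2 ⟨hT₁ p (hfib l p fun c => ?_),
    hT₂ q (hfib m q fun c => ?_)⟩⟩
  · rw [Finset.card_product]
    push_cast
    have hfac : ∀ i, (2 * (1 + 1 / l (χ i))) * (2 * (1 + 1 / m (χ i))) ≤
        z ^ 7 * D * (if χ i ≠ 0 then 1 / √(n : ℝ) else 1) := by
      intro i
      have hz5 : z ^ 5 * 36 ≤ z ^ 7 := by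
        have h1 : z ^ 7 = z ^ 5 * z ^ 2 := by ring
        rw [h1]; gcongr; nlinarith
      by_cases hi : χ i = 0
      · have h3 : 1 / m (χ i) = 2 * z ^ 2 * D := by
          simp only [hm, hi, ha0]; field_simp
        have h4 : l (χ i) = 1 := by simp [hl, hi]
        rw [h3, h4, if_neg (not_not.2 hi)]
        have h5 : z ^ 2 * 216 ≤ z ^ 5 := by
          have h1 : z ^ 5 = z ^ 2 * z ^ 3 := by ring
          have h2 : (6 : ℝ) ^ 3 ≤ z ^ 3 := by gcongr
          rw [h1]; gcongr; linarith
        have h6 : 36 ≤ z ^ 2 := by nlinarith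
        calc 2 * (1 + 1 / 1) * (2 * (1 + 2 * z ^ 2 * D)) = 8 + 16 * z ^ 2 * D := by ring
          _ ≤ 24 * z ^ 2 * D := by nlinarith
          _ ≤ z ^ 7 * D := by gcongr; linarith
          _ = _ := by ring
      · have hac := ha0' (χ i)
        have h3 : 1 / m (χ i) = 2 * z ^ 2 * (D : ℝ) ^ 2 / a (χ i) := by
          simp only [hm]; field_simp
        have h4 : 1 / l (χ i) = 2 * z ^ 3 * a (χ i) / (√n * D) := by
          simp only [hl, hi, if_false]; field_simp
        have h5 : 1 ≤ z ^ 3 * a (χ i) / (√n * D) := by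
          rw [one_le_div (by positivity)]
          refine (ha _ hi).trans ?_
          gcongr
          exact le_self_pow₀ (by linarith) (by norm_num)
        have h6 : 1 ≤ z ^ 2 * (D : ℝ) ^ 2 / a (χ i) := by
          rw [one_le_div hac]
          refine (ha2 _).trans ?_
          gcongr
          exact le_self_pow₀ (by linarith) (by norm_num)
        rw [h3, h4, if_pos hi]
        calc _ ≤ (6 * (z ^ 3 * a (χ i) / (√n * D))) * (6 * (z ^ 2 * (D : ℝ) ^ 2 / a (χ i))) := by
              have e1 : 2 * z ^ 3 * a (χ i) / (√n * D) = 2 * (z ^ 3 * a (χ i) / (√n * D)) := by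
                ring
              have e2 : 2 * z ^ 2 * (D : ℝ) ^ 2 / a (χ i) =
                2 * (z ^ 2 * (D : ℝ) ^ 2 / a (χ i)) := by ring
              rw [e1, e2]
              exact mul_le_mul (by linarith) (by linarith) (by linarith) (by linarith)
          _ = z ^ 5 * 36 * (D * (1 / √n)) := by field_simp; ring
          _ ≤ z ^ 7 * (D * (1 / √n)) := by gcongr
          _ = _ := by ring
    have hpos : ∀ w : ℝ, 0 < w → 0 ≤ 2 * (1 + 1 / w) := fun w hw => by positivity
    calc (T₁.card : ℝ) * T₂.card
        ≤ (Real.exp (((k + 1 : ℕ) : ℝ) * n) * ∏ i, (2 * (1 + 1 / l (χ i)))) *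
          (Real.exp (((k + 1 : ℕ) : ℝ) * n) * ∏ i, (2 * (1 + 1 / m (χ i)))) := by
          refine mul_le_mul hc₁ hc₂ (by positivity) ?_
          exact mul_nonneg (Real.exp_nonneg _) (Finset.prod_nonneg fun i _ => hpos _ (hl0 _))
      _ = Real.exp (2 * (k + 1) * n) *
          ∏ i, ((2 * (1 + 1 / l (χ i))) * (2 * (1 + 1 / m (χ i)))) := by
          rw [Finset.prod_mul_distrib (f := fun i => 2 * (1 + 1 / l (χ i)))
            (g := fun i => 2 * (1 + 1 / m (χ i)))]
          have : Real.exp (2 * (k + 1) * n) =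
              Real.exp (((k + 1 : ℕ) : ℝ) * n) * Real.exp (((k + 1 : ℕ) : ℝ) * n) := by
            rw [← Real.exp_add]; congr 1; push_cast; ring
          rw [this]
          exact mul_mul_mul_comm _ _ _ _
      _ ≤ Real.exp (2 * (k + 1) * n) *
          ∏ i, (z ^ 7 * D * (if χ i ≠ 0 then 1 / √(n : ℝ) else 1)) := by
          refine mul_le_mul_of_nonneg_left (Finset.prod_le_prod (fun i _ => ?_)
            fun i _ => hfac i) (Real.exp_nonneg _)
          exact mul_nonneg (hpos _ (hl0 _)) (hpos _ (hm0 _))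
      _ = Real.exp (2 * (k + 1) * n) * (z ^ 7 * D) ^ n *
          (1 / √n) ^ (Finset.univ.filter fun i => χ i ≠ 0).card := by
          rw [Finset.prod_mul_distrib, Finset.prod_const, Finset.card_univ, Fintype.card_fin,
            ← Finset.prod_filter, Finset.prod_const]
          exact (mul_assoc _ _ _).symm
      _ ≤ _ := by
          refine mul_le_mul_of_nonneg_left ?_ (by positivity)
          exact pow_le_pow_of_le_one (by positivity) ((div_le_one hN).2 hN1) hχ
  · by_cases hc : c = 0
    · have : ∑ i with χ i = c, |(p i : ℝ)| = 0 := Finset.sum_eq_zero fun i hi => by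
        rw [hp0 i ((Finset.mem_filter.1 hi).2.trans hc)]; simp
      rw [this, mul_zero]
      exact hn0.le
    · have hac := ha0' c
      calc l c * ∑ i with χ i = c, |(p i : ℝ)| ≤ l c * (√n * (2 * z ^ 3 * a c / D)) :=
            mul_le_mul_of_nonneg_left (hp c hc) (hl0 c).le
        _ = √n * √n := by simp only [hl, hc, if_false]; field_simp
        _ ≤ n := hNN.le
  · have hac := ha0' c
    calc m c * ∑ i with χ i = c, |(q i : ℝ)| ≤ m c * (n * (2 * z ^ 2 * (D : ℝ) ^ 2 / a c)) :=
          mul_le_mul_of_nonneg_left (hq c) (hm0 c).le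
      _ = n := by simp only [hm]; field_simp
      _ ≤ n := le_rfl

/-- `v` is approximated blockwise by lattice vectors: the coordinates are coloured by `χ`, at least
`m₁` of them with a nonzero colour, and on each class of nonzero colour `c` the dilation of `v` by
`s c` is within `z ^ 2` of the lattice vector `p`. The colour `0` collects the coordinates on which
`v` is neither dilated nor approximated. -/
structure BlockApprox {n k : ℕ} (z : ℝ) (D m₁ : ℕ) (v : EuclideanSpace ℝ (Fin n))
    (χ : Fin n → Fin (k + 1)) (s : Fin (k + 1) → ℝ) (p : Fin n → ℤ) : Prop where
  le_card : m₁ ≤ (Finset.univ.filter fun i => χ i ≠ 0).card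
  zero : s 0 = 1
  lower : ∀ c, c ≠ 0 → 2 * √n / z ≤ s c
  upper : ∀ c, c ≠ 0 → s c ≤ z * D
  eq_zero : ∀ i, χ i = 0 → p i = 0
  close : ∀ c, ∑ i with χ i = c, (s c * v i - p i) ^ 2 ≤ (z ^ 2) ^ 2

/-- The unit vectors with a blockwise lattice approximation have few codes. -/
lemma exists_codes {n D : ℕ} (k m₁ : ℕ) {z : ℝ} (hn : 0 < n) (hD : 1 ≤ D) (hz : 6 ≤ z)
    (hzn : z ≤ √n) :
    ∃ T : Finset ((Fin n → Fin (k + 1)) × (Fin (k + 1) → ℕ) × (Fin n → ℤ) × (Fin n → ℤ)),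
      (T.card : ℝ) ≤ ((k + 1 : ℕ) : ℝ) ^ n * (z * (D : ℝ) ^ 2 + 1) ^ (k + 1) *
        (Real.exp (2 * (k + 1) * n) * (z ^ 7 * D) ^ n * (1 / √n) ^ m₁) ∧
      ∀ v : EuclideanSpace ℝ (Fin n), ‖v‖ = 1 →
        (∃ (χ : Fin n → Fin (k + 1)) (s : Fin (k + 1) → ℝ) (p : Fin n → ℤ),
          BlockApprox z D m₁ v χ s p) → ∃ κ ∈ T, HasCode D v κ := by
  classical
  have hn0 : (0 : ℝ) < n := by exact_mod_cast hn
  have hN : 0 < √(n : ℝ) := Real.sqrt_pos.2 hn0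
  have hNN : √(n : ℝ) * √n = n := Real.mul_self_sqrt hn0.le
  have hD1 : (1 : ℝ) ≤ D := by exact_mod_cast hD
  have hz0 : 0 < z := by linarith
  set B : ℝ := Real.exp (2 * (k + 1) * n) * (z ^ 7 * D) ^ n * (1 / √n) ^ m₁ with hB
  have hB0 : 0 ≤ B := by positivity
  set X : Finset (Fin n → Fin (k + 1)) :=
    Finset.univ.filter fun χ => m₁ ≤ (Finset.univ.filter fun i => χ i ≠ 0).card with hX
  set A : Finset (Fin (k + 1) → ℕ) :=
    (Fintype.piFinset fun _ => Finset.range (⌊z * (D : ℝ) ^ 2⌋₊ + 1)).filter fun a =>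
      a 0 = D ∧ (∀ c, c ≠ 0 → √n * D ≤ z * a c) ∧ ∀ c, 1 ≤ a c with hA
  have hAle : ∀ a ∈ A, ∀ c, (a c : ℝ) ≤ z * (D : ℝ) ^ 2 := by
    intro a ha c
    have h1 := Fintype.mem_piFinset.1 (Finset.mem_filter.1 ha).1 c
    have h2 : a c ≤ ⌊z * (D : ℝ) ^ 2⌋₊ := Nat.lt_succ_iff.1 (Finset.mem_range.1 h1)
    exact (Nat.cast_le.2 h2).trans (Nat.floor_le (by positivity))
  have hch : ∀ χa : (Fin n → Fin (k + 1)) × (Fin (k + 1) → ℕ),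
      ∃ T : Finset ((Fin n → ℤ) × (Fin n → ℤ)), χa ∈ X ×ˢ A → (T.card : ℝ) ≤ B ∧
      ∀ p q : Fin n → ℤ, (∀ i, χa.1 i = 0 → p i = 0) →
        (∀ c, c ≠ 0 → ∑ i with χa.1 i = c, |(p i : ℝ)| ≤ √n * (2 * z ^ 3 * χa.2 c / D)) →
        (∀ c, ∑ i with χa.1 i = c, |(q i : ℝ)| ≤ n * (2 * z ^ 2 * (D : ℝ) ^ 2 / χa.2 c)) →
        (p, q) ∈ T := by
    intro χa
    by_cases h : χa ∈ X ×ˢ A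
    · have h' := Finset.mem_product.1 h
      have hA' := (Finset.mem_filter.1 h'.2).2
      obtain ⟨T, hT⟩ := exists_finset_pairs (m₁ := m₁) hn hD hz χa.1 χa.2
        (Finset.mem_filter.1 h'.1).2 hA'.1 hA'.2.1 hA'.2.2 (hAle _ h'.2)
      exact ⟨T, fun _ => hT⟩
    · exact ⟨∅, fun h' => absurd h' h⟩
  choose T' hT' using hch
  refine ⟨(X ×ˢ A).biUnion fun χa => (T' χa).image fun pq => (χa.1, χa.2, pq.1, pq.2), ?_, ?_⟩
  · have hXc : (X.card : ℝ) ≤ ((k + 1 : ℕ) : ℝ) ^ n := by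
      have : X.card ≤ (k + 1) ^ n := by
        refine (Finset.card_le_univ _).trans ?_
        simp
      exact_mod_cast this
    have hAc : (A.card : ℝ) ≤ (z * (D : ℝ) ^ 2 + 1) ^ (k + 1) := by
      have h1 : A.card ≤ (⌊z * (D : ℝ) ^ 2⌋₊ + 1) ^ (k + 1) := by
        refine (Finset.card_filter_le _ _).trans ?_
        simp [Fintype.card_piFinset]
      calc (A.card : ℝ) ≤ ((⌊z * (D : ℝ) ^ 2⌋₊ : ℝ) + 1) ^ (k + 1) := by exact_mod_cast h1
        _ ≤ _ := by gcongr; exact Nat.floor_le (by positivity)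
    calc _ ≤ ((∑ χa ∈ X ×ˢ A, ((T' χa).image fun pq => (χa.1, χa.2, pq.1, pq.2)).card : ℕ) : ℝ) :=
          by exact_mod_cast Finset.card_biUnion_le
      _ ≤ ∑ _χa ∈ X ×ˢ A, B := by
          push_cast
          refine Finset.sum_le_sum fun χa h => le_trans ?_ (hT' χa h).1
          exact_mod_cast Finset.card_image_le
      _ = (X.card : ℝ) * A.card * B := by
          rw [Finset.sum_const, Finset.card_product, nsmul_eq_mul]; push_cast; ring
      _ ≤ _ := by gcongr
  · rintro v hv ⟨χ, s, p, h⟩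
    have hs1 : ∀ c, 1 ≤ s c := by
      intro c
      by_cases hc : c = 0
      · rw [hc, h.zero]
      · refine le_trans ?_ (h.lower c hc)
        rw [le_div_iff₀ hz0]; linarith
    set a : Fin (k + 1) → ℕ := fun c => ⌊s c * D⌋₊ with ha
    have hsD : ∀ c, 1 ≤ s c * D := fun c => by nlinarith [hs1 c]
    have ha1 : ∀ c, 1 ≤ a c := fun c => Nat.le_floor (by simpa using hsD c)
    have ha1' : ∀ c, (1 : ℝ) ≤ a c := fun c => by exact_mod_cast ha1 c
    have has : ∀ c, (a c : ℝ) ≤ s c * D := fun c => Nat.floor_le (by linarith [hsD c])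
    have hsa : ∀ c, s c * D < a c + 1 := fun c => Nat.lt_floor_add_one _
    have ha0 : a 0 = D := by simp [ha, h.zero]
    have hsz : ∀ c, s c ≤ z * D := fun c => by
      by_cases hc : c = 0
      · rw [hc, h.zero]; nlinarith
      · exact h.upper c hc
    have haz : ∀ c, (a c : ℝ) ≤ z * (D : ℝ) ^ 2 := fun c => by
      have := hsz c
      calc (a c : ℝ) ≤ s c * D := has c
        _ ≤ z * D * D := by gcongr
        _ = _ := by ring
    have hal : ∀ c, c ≠ 0 → √n * D ≤ z * a c := by
      intro c hc
      have h1 := h.lower c hc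
      rw [div_le_iff₀ hz0] at h1
      have h2 := (hsa c).le
      have h3 : 2 * √n * D ≤ z * (a c + 1) := by
        calc 2 * √n * D ≤ s c * z * D := by gcongr
          _ = z * (s c * D) := by ring
          _ ≤ _ := by gcongr
      nlinarith
    have hmem : (χ, a) ∈ X ×ˢ A := by
      refine Finset.mem_product.2 ⟨Finset.mem_filter.2 ⟨Finset.mem_univ _, h.le_card⟩,
        Finset.mem_filter.2 ⟨Fintype.mem_piFinset.2 fun c => ?_, ha0, hal, ha1⟩⟩
      exact Finset.mem_range.2 (Nat.lt_succ_iff.2 (Nat.le_floor (haz c)))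
    set q : Fin n → ℤ := fun i => ⌊(s (χ i) * v i - p i) / (a (χ i) / ((D : ℝ) ^ 2 * √n))⌋ with hq
    have hclose : ∀ c, ∑ i with χ i = c, |s c * v i - p i| ≤ √n * z ^ 2 := fun c =>
      sum_abs_le_sqrt_mul _ _ (by positivity) (h.close c)
    have hvs : ∀ c, ∑ i with χ i = c, |v i| ≤ √n * 1 := fun c => by
      refine sum_abs_le_sqrt_mul _ _ zero_le_one ?_
      have h1 := EuclideanSpace.norm_sq_eq v
      simp only [Real.norm_eq_abs, sq_abs, hv] at h1
      rw [h1]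
      exact Finset.sum_le_univ_sum_of_nonneg fun i => sq_nonneg _
    refine ⟨(χ, a, p, q), Finset.mem_biUnion.2 ⟨(χ, a), hmem, Finset.mem_image.2 ⟨(p, q),
      (hT' _ hmem).2 p q h.eq_zero (fun c hc => ?_) (fun c => ?_), rfl⟩⟩, s, hs1, fun c => rfl,
      fun i => rfl⟩
    · calc ∑ i with χ i = c, |(p i : ℝ)|
          ≤ ∑ i with χ i = c, (s c * |v i| + |s c * v i - p i|) := by
            refine Finset.sum_le_sum fun i _ => ?_
            rw [← abs_of_pos (by linarith [hs1 c] : 0 < s c), ← abs_mul,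
              abs_of_pos (by linarith [hs1 c] : 0 < s c)]
            have := abs_sub (s c * v i) (s c * v i - p i)
            simpa using this
        _ ≤ s c * √n + √n * z ^ 2 := by
            rw [Finset.sum_add_distrib, ← Finset.mul_sum]
            have := hvs c
            rw [mul_one] at this
            have h0 := hs1 c
            exact add_le_add (mul_le_mul_of_nonneg_left this (by linarith)) (hclose c)
        _ = √n * (s c + z ^ 2) := by ring
        _ ≤ √n * (2 * z ^ 3 * a c / D) := by
            have h1 : (1 : ℝ) ≤ a c / D := by
              rw [le_div_iff₀ (by linarith), one_mul]
              have := hal c hc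
              have h2 : z * D ≤ z * a c := le_trans (by gcongr) this
              exact le_of_mul_le_mul_left h2 hz0
            have h2 : s c ≤ 2 * (a c / D) := by
              rw [← mul_div_assoc, le_div_iff₀ (by linarith)]
              linarith [hsa c, ha1' c]
            have h3 : (36 : ℝ) ≤ z ^ 2 := by nlinarith
            have h4 : z ^ 2 ≤ z ^ 3 := pow_le_pow_right₀ (by linarith) (by norm_num)
            have h5 : s c + z ^ 2 ≤ 2 * z ^ 3 * (a c / D) := by nlinarith
            rw [mul_div_assoc]
            gcongr
    · have hac : (0 : ℝ) < a c := by linarith [ha1' c]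
      set g : ℝ := a c / ((D : ℝ) ^ 2 * √n) with hg
      have hg0 : 0 < g := by positivity
      calc ∑ i with χ i = c, |(q i : ℝ)|
          ≤ ∑ i with χ i = c, (|s c * v i - p i| / g + 1) := by
            refine Finset.sum_le_sum fun i hi => ?_
            have hi' := (Finset.mem_filter.1 hi).2
            simp only [hq, hi']
            have e : |s c * v i - p i| / g = |(s c * v i - p i) / g| := by
              rw [abs_div, abs_of_pos hg0]
            rw [e, ← hg]
            have h1 := Int.floor_le ((s c * v i - p i) / g)
            have h2 := Int.lt_floor_add_one ((s c * v i - p i) / g)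
            have h3 := neg_abs_le ((s c * v i - p i) / g)
            have h4 := le_abs_self ((s c * v i - p i) / g)
            rw [abs_le]
            constructor <;> linarith
        _ ≤ √n * z ^ 2 / g + n := by
            rw [Finset.sum_add_distrib, ← Finset.sum_div]
            refine add_le_add (by gcongr; exact hclose c) ?_
            rw [Finset.sum_const, nsmul_eq_mul, mul_one]
            have := Finset.card_le_univ (Finset.univ.filter fun i => χ i = c)
            rw [Fintype.card_fin] at this
            exact_mod_cast this
        _ = n * (z ^ 2 * (D : ℝ) ^ 2 / a c + 1) := by
            have e : √n * z ^ 2 / g = (√n * √n) * (z ^ 2 * (D : ℝ) ^ 2 / a c) := by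
              rw [hg]; field_simp
            rw [e, hNN]; ring
        _ ≤ n * (2 * z ^ 2 * (D : ℝ) ^ 2 / a c) := by
            have h6 : 1 ≤ z ^ 2 * (D : ℝ) ^ 2 / a c := by
              rw [one_le_div hac]
              refine (haz c).trans ?_
              gcongr
              exact le_self_pow₀ (by linarith) (by norm_num)
            have e2 : 2 * z ^ 2 * (D : ℝ) ^ 2 / a c =
                2 * (z ^ 2 * (D : ℝ) ^ 2 / a c) := by ring
            rw [e2]
            gcongr
            linarith

/-! ### Lattice approximation of vectors with small regularized LCD -/

lemma sum_sub_round_sq_le {ι : Type*} [Fintype ι] {x : EuclideanSpace ℝ ι} {ρ : ℝ}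
    (h : Metric.infDist x (intLattice ι) < ρ) : ∑ i, (x i - round (x i)) ^ 2 ≤ ρ ^ 2 := by
  obtain ⟨p, hp, hd⟩ := (Metric.infDist_lt_iff (intLattice_nonempty ι)).1 h
  have h1 := pow_le_pow_left₀ dist_nonneg hd.le 2
  refine le_trans ?_ h1
  rw [dist_eq_norm, EuclideanSpace.norm_sq_eq]
  refine Finset.sum_le_sum fun i _ => ?_
  obtain ⟨k, hk⟩ := hp i
  rw [PiLp.sub_apply, hk, Real.norm_eq_abs, ← sq_abs (x i - round (x i))]
  exact pow_le_pow_left₀ (abs_nonneg _) (round_le (x i) k) 2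

/-- A finite set with at least `k * m` elements has `k` disjoint subsets of size `m`: the classes of
nonzero colour of a colouring. -/
lemma exists_colouring {n : ℕ} (S : Finset (Fin n)) (k m : ℕ) (h : k * m ≤ S.card) :
    ∃ χ : Fin n → Fin (k + 1), k * m ≤ (Finset.univ.filter fun i => χ i ≠ 0).card ∧
      ∀ c, c ≠ 0 → (Finset.univ.filter fun i => χ i = c) ⊆ S ∧
        (Finset.univ.filter fun i => χ i = c).card = m := by
  classical
  obtain ⟨e⟩ : Nonempty (Fin k × Fin m ↪ S) :=
    Function.Embedding.nonempty_of_card_le (by simpa using h)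
  set f : Fin k × Fin m ↪ Fin n := e.trans (Function.Embedding.subtype _) with hf
  set χ : Fin n → Fin (k + 1) := Function.extend f (fun q => q.1.succ) fun _ => 0 with hχ
  have hfS : ∀ q, f q ∈ S := fun q => (e q).2
  have h1 : ∀ q, χ (f q) = q.1.succ := fun q => f.injective.extend_apply _ _ _
  have h2 : ∀ i, χ i ≠ 0 → ∃ q, f q = i := by
    intro i hi
    by_contra hne
    exact hi (Function.extend_apply' _ _ _ hne)
  refine ⟨χ, ?_, fun c hc => ?_⟩
  · have hsub : Finset.univ.map f ⊆ Finset.univ.filter fun i => χ i ≠ 0 := by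
      intro i hi
      obtain ⟨q, -, rfl⟩ := Finset.mem_map.1 hi
      refine Finset.mem_filter.2 ⟨Finset.mem_univ _, ?_⟩
      rw [h1]
      exact Fin.succ_ne_zero _
    simpa using Finset.card_le_card hsub
  · obtain ⟨d, rfl⟩ := Fin.exists_succ_eq.2 hc
    have heq : (Finset.univ.filter fun i => χ i = d.succ) =
        Finset.univ.map ⟨fun j => f (d, j), fun j j' hj => by simpa using f.injective hj⟩ := by
      ext i
      simp only [Finset.mem_filter, Finset.mem_univ, true_and, Finset.mem_map]
      constructor
      · intro hi
        obtain ⟨q, rfl⟩ := h2 i (by rw [hi]; exact Fin.succ_ne_zero _)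
        rw [h1] at hi
        exact ⟨q.2, by rw [← Fin.succ_injective _ hi]; rfl⟩
      · rintro ⟨j, rfl⟩
        exact h1 _
    rw [heq]
    refine ⟨fun i hi => ?_, by simp⟩
    obtain ⟨j, -, rfl⟩ := Finset.mem_map.1 hi
    exact hfS _

/-- A vector of small regularized LCD is close to the lattice, after dilation, on each of `k`
disjoint blocks of its spread part. -/
lemma exists_blockApprox {n D k m : ℕ} {L γ z b₀ b₁ : ℝ}
    {spread : EuclideanSpace ℝ (Fin n) → Finset (Fin n)} {v : EuclideanSpace ℝ (Fin n)}
    (hv : ‖v‖ = 1) (hn : 0 < n) (hD : 1 ≤ D) (hm : m = ⌈γ * n⌉₊) (hk : k * m ≤ (spread v).card)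
    (hb₀ : 0 < b₀) (hb₁ : 0 < b₁)
    (hlow : ∀ I ⊆ spread v, I.card = m → b₀ ≤ ‖restrict v I‖)
    (hup : ∀ i ∈ spread v, |v i| ≤ b₁ / √n) (hL : 1 ≤ L) (hLz : L ≤ z)
    (hlog : Real.log D ≤ z ^ 2) (hz₀ : 1 / b₀ ≤ z) (hz₁ : 4 * b₁ / b₀ ≤ z)
    (hreg : regLCD spread L γ v < D) :
    ∃ (χ : Fin n → Fin (k + 1)) (s : Fin (k + 1) → ℝ) (p : Fin n → ℤ),
      BlockApprox z D (k * m) v χ s p := by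
  have hn0 : (0 : ℝ) < n := by exact_mod_cast hn
  have hN : 0 < √(n : ℝ) := Real.sqrt_pos.2 hn0
  have hD1 : (1 : ℝ) ≤ D := by exact_mod_cast hD
  have hL0 : 0 < L := by linarith
  have hz0 : 0 < z := by linarith
  obtain ⟨χ, hχ, hcl⟩ := exists_colouring (spread v) k m hk
  have key : ∀ c : Fin (k + 1), ∃ s : ℝ, (c = 0 → s = 1) ∧ (c ≠ 0 → 2 * √n / z ≤ s ∧ s ≤ z * D ∧
      ∑ i with χ i = c, (s * v i - round (s * v i)) ^ 2 ≤ (z ^ 2) ^ 2) := by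
    intro c
    by_cases hc : c = 0
    · exact ⟨1, fun _ => rfl, fun h => absurd hc h⟩
    obtain ⟨hIS, hIm⟩ := hcl c hc
    set I : Finset (Fin n) := Finset.univ.filter fun i => χ i = c with hI
    have hr : b₀ ≤ ‖restrict v I‖ := hlow I hIS hIm
    have hr0 : 0 < ‖restrict v I‖ := hb₀.trans_le hr
    have hr1 : ‖restrict v I‖ ≤ 1 := (norm_restrict_le v I).trans hv.le
    obtain ⟨θ, hθ0, hθD, hθ⟩ := exists_int_near_of_lcd_lt hL0
      ((lcd_le_regLCD (L := L) hIS (hIm.trans hm)).trans_lt hreg)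
    refine ⟨θ / ‖restrict v I‖, fun h => absurd h hc, fun _ => ⟨?_, ?_, ?_⟩⟩
    · have hhalf : 1 / 2 ≤ θ * (b₁ / √n / b₀) := by
        refine half_le_mul_of_infDist_lt ?_ hL0 hθ0 (fun i => ?_) hθ
        · rw [norm_smul, norm_inv, norm_norm, inv_mul_cancel₀ hr0.ne']
        · have h1 : (‖restrict v I‖⁻¹ • restrict v I) i = v i / ‖restrict v I‖ := by
            simp [restrict]; ring
          rw [h1, abs_div, abs_of_pos hr0]
          have := hup i (hIS i.2)
          gcongr
      have h2 : 2 * √n / z ≤ θ := by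
        rw [div_le_iff₀ hz0]
        have e : θ * (b₁ / √n / b₀) = θ * (4 * b₁ / b₀) / (4 * √n) := by field_simp
        rw [e, le_div_iff₀ (by positivity)] at hhalf
        have : θ * (4 * b₁ / b₀) ≤ θ * z := by gcongr
        linarith
      refine h2.trans ?_
      rw [le_div_iff₀ hr0]
      exact mul_le_of_le_one_right hθ0.le hr1
    · calc θ / ‖restrict v I‖ ≤ D / b₀ := by gcongr
        _ = 1 / b₀ * D := by ring
        _ ≤ z * D := by gcongr
    · have hρ : L * √(Real.posLog (θ / L)) ≤ z ^ 2 := by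
        have h1 : Real.posLog (θ / L) ≤ z ^ 2 := by
          have h2 : θ / L ≤ D := (div_le_self hθ0.le hL).trans hθD.le
          refine (Real.posLog_le_posLog (by positivity) h2).trans ?_
          rw [Real.posLog_apply]
          exact max_le (by positivity) hlog
        calc L * √(Real.posLog (θ / L)) ≤ z * z := by
              gcongr
              exact Real.sqrt_le_iff.2 ⟨hz0.le, h1⟩
          _ = z ^ 2 := by ring
      have h3 := sum_sub_round_sq_le (hθ.trans_le hρ)
      have h4 : ∀ i : I, (θ • ‖restrict v I‖⁻¹ • restrict v I) i = θ / ‖restrict v I‖ * v i := by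
        intro i
        simp [restrict]
        ring
      simp only [h4] at h3
      rwa [Finset.sum_coe_sort I fun i => (θ / ‖restrict v I‖ * v i -
        round (θ / ‖restrict v I‖ * v i)) ^ 2] at h3
  choose s hs0 hs using key
  refine ⟨χ, s, fun i => if χ i = 0 then 0 else round (s (χ i) * v i), hχ, hs0 0 rfl,
    fun c hc => (hs c hc).1, fun c hc => (hs c hc).2.1, fun i hi => if_pos hi, fun c => ?_⟩
  by_cases hc : c = 0
  · have hz1 : 1 ≤ z := by linarith
    calc ∑ i with χ i = c, (s c * v i - ((if χ i = 0 then 0 else round (s (χ i) * v i) : ℤ) : ℝ)) ^ 2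
        = ∑ i with χ i = c, v i ^ 2 := by
          refine Finset.sum_congr rfl fun i hi => ?_
          rw [if_pos ((Finset.mem_filter.1 hi).2.trans hc), hs0 c hc]
          simp
      _ ≤ ∑ i, v i ^ 2 := Finset.sum_le_univ_sum_of_nonneg fun i => sq_nonneg _
      _ = 1 := by
          have h1 := EuclideanSpace.norm_sq_eq v
          simp only [Real.norm_eq_abs, sq_abs, hv] at h1
          simpa using h1.symm
      _ ≤ (z ^ 2) ^ 2 := one_le_pow₀ (one_le_pow₀ hz1)
  · refine le_trans (le_of_eq ?_) (hs c hc).2.2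
    refine Finset.sum_congr rfl fun i hi => ?_
    have hi' := (Finset.mem_filter.1 hi).2
    rw [if_neg (by rwa [hi']), hi']

lemma le_norm_restrict {n : ℕ} {c γ : ℝ} (hn : 0 < n) (hc : 0 < c) (hγ : 0 < γ)
    {v : EuclideanSpace ℝ (Fin n)} {I : Finset (Fin n)} (hI : γ * n ≤ I.card)
    (h : ∀ i ∈ I, c / √(2 * n) ≤ |v i|) : c * √(γ / 2) ≤ ‖restrict v I‖ := by
  have hn0 : (0 : ℝ) < n := by exact_mod_cast hn
  refine le_of_sq_le_sq ?_ (norm_nonneg _)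
  rw [norm_restrict_sq, mul_pow, Real.sq_sqrt (by positivity)]
  calc c ^ 2 * (γ / 2) = γ * n * (c / √(2 * n)) ^ 2 := by
        rw [div_pow, Real.sq_sqrt (by positivity)]; field_simp
    _ ≤ I.card * (c / √(2 * n)) ^ 2 := by gcongr
    _ = ∑ _i ∈ I, (c / √(2 * n)) ^ 2 := by simp
    _ ≤ ∑ i ∈ I, v i ^ 2 := by
        refine Finset.sum_le_sum fun i hi => ?_
        rw [← sq_abs (v i)]
        exact pow_le_pow_left₀ (by positivity) (h i hi) 2

/-! ### The union bound on a level set -/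

lemma norm_toEuclideanLin_le {n : ℕ} (A : Matrix (Fin n) (Fin n) ℝ)
    (x : EuclideanSpace ℝ (Fin n)) :
    ‖Matrix.toEuclideanLin A x‖ ≤ spectralNorm A * ‖x‖ := by
  have h := (Matrix.toEuclideanCLM (n := Fin n) (𝕜 := ℝ) A).le_opNorm x
  exact h

lemma abs_eigenvalue_le {n : ℕ} {A : Matrix (Fin n) (Fin n) ℝ} {v : EuclideanSpace ℝ (Fin n)}
    {μ : ℝ} (hv : ‖v‖ = 1) (h : Matrix.toEuclideanLin A v = μ • v) : |μ| ≤ spectralNorm A := by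
  have h1 := norm_toEuclideanLin_le A v
  rwa [h, norm_smul, hv, mul_one, mul_one] at h1

/-- An approximate eigenvector is obtained by perturbing both the eigenvector and the eigenvalue. -/
lemma norm_toEuclideanLin_sub_le {n : ℕ} {A : Matrix (Fin n) (Fin n) ℝ}
    {v x : EuclideanSpace ℝ (Fin n)} {μ ν K r s : ℝ} (hx : ‖x‖ = 1)
    (h : Matrix.toEuclideanLin A v = μ • v) (hA : spectralNorm A ≤ K) (hμ : |μ| ≤ K)
    (hvx : ‖v - x‖ ≤ r) (hμν : |μ - ν| ≤ s) :
    ‖Matrix.toEuclideanLin A x - ν • x‖ ≤ 2 * K * r + s := by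
  have hK : 0 ≤ K := (abs_nonneg _).trans hμ
  have e : Matrix.toEuclideanLin A x - ν • x =
      -(Matrix.toEuclideanLin A (v - x)) + μ • (v - x) + (μ - ν) • x := by
    rw [map_sub, h]; module
  rw [e]
  calc _ ≤ ‖Matrix.toEuclideanLin A (v - x)‖ + ‖μ • (v - x)‖ + ‖(μ - ν) • x‖ := by
        refine (norm_add_le _ _).trans (add_le_add ((norm_add_le _ _).trans ?_) le_rfl)
        rw [norm_neg]
    _ ≤ K * r + K * r + s := by
        rw [norm_smul, norm_smul, hx, mul_one, Real.norm_eq_abs, Real.norm_eq_abs]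
        have h1 := norm_toEuclideanLin_le A (v - x)
        have h2 : spectralNorm A * ‖v - x‖ ≤ K * r := by gcongr
        have h3 : |μ| * ‖v - x‖ ≤ K * r := by gcongr
        linarith
    _ = _ := by ring

section

variable {Ω Ω₀ : Type*} [MeasurableSpace Ω] [MeasurableSpace Ω₀] {P : Measure Ω}
  {P₀ : Measure Ω₀} {ξ ζ : Ω₀ → ℝ} {n : ℕ} {W : Ω → Matrix (Fin n) (Fin n) ℝ}

/-- If a net `R` of a set `S` of unit vectors satisfies a uniform small ball estimate, then it is
unlikely that `S` contains an eigenvector: one also discretizes the eigenvalue. -/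
lemma measureReal_exists_eigenvector_le [IsProbabilityMeasure P]
    {S : Set (EuclideanSpace ℝ (Fin n))} (R : Finset (EuclideanSpace ℝ (Fin n)))
    {D : ℕ} {M z b : ℝ} (hn : 0 < n) (hD : 1 ≤ D) (hM : 1 ≤ M) (hz : 6 ≤ z) (hMz : 5 * M ≤ z)
    (hS : ∀ v ∈ S, ‖v‖ = 1) (hRS : ↑R ⊆ S) (hnet : ∀ v ∈ S, ∃ x ∈ R, ‖v - x‖ ≤ 2 / D)
    (hb : ∀ x ∈ R, ∀ ν : ℝ,
      P.real {ω | ‖Matrix.toEuclideanLin (W ω) x - ν • x‖ ≤ z / D * √n} ≤ b) :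
    P.real {ω | (∃ v : EuclideanSpace ℝ (Fin n), IsEigenvector (W ω) v ∧ v ∈ S) ∧
      spectralNorm (W ω) ≤ M * √n} ≤ R.card * (2 * z * D) * b := by
  have hn0 : (0 : ℝ) < n := by exact_mod_cast hn
  have hN : 0 < √(n : ℝ) := Real.sqrt_pos.2 hn0
  have hD1 : (1 : ℝ) ≤ D := by exact_mod_cast hD
  set Λ : Finset ℤ := Finset.Icc (-⌈M * D⌉ - 1) ⌈M * D⌉ with hΛ
  have hsub : {ω | (∃ v : EuclideanSpace ℝ (Fin n), IsEigenvector (W ω) v ∧ v ∈ S) ∧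
      spectralNorm (W ω) ≤ M * √n} ⊆ ⋃ x ∈ R, ⋃ l ∈ Λ,
      {ω | ‖Matrix.toEuclideanLin (W ω) x - ((l : ℝ) * √n / D) • x‖ ≤ z / D * √n} := by
    rintro ω ⟨⟨v, ⟨μ, hμ⟩, hvS⟩, hW⟩
    have hμ' := hμ.apply_eq_smul
    have hμM : |μ| ≤ M * √n := (abs_eigenvalue_le (hS v hvS) hμ').trans hW
    obtain ⟨x, hxR, hx⟩ := hnet v hvS
    set l : ℤ := ⌊μ * D / √n⌋ with hl
    have h1 : |μ * D / √n| ≤ M * D := by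
      rw [abs_div, abs_mul, abs_of_pos hN, abs_of_pos (by linarith : (0 : ℝ) < D),
        div_le_iff₀ hN]
      calc |μ| * D ≤ M * √n * D := by gcongr
        _ = _ := by ring
    have h2 := abs_le.1 h1
    have h3 : |μ - (l : ℝ) * √n / D| ≤ √n / D := by
      have e : μ - (l : ℝ) * √n / D = Int.fract (μ * D / √n) * (√n / D) := by
        rw [Int.fract, ← hl]; field_simp
      rw [e, abs_mul, abs_of_nonneg (Int.fract_nonneg _),
        abs_of_nonneg (by positivity : 0 ≤ √(n : ℝ) / D)]
      exact mul_le_of_le_one_left (by positivity) (Int.fract_lt_one _).le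
    refine Set.mem_biUnion hxR (Set.mem_biUnion (x := l) ?_ ?_)
    · refine Finset.mem_coe.2 (Finset.mem_Icc.2 ⟨?_, ?_⟩)
      · have := Int.lt_floor_add_one (μ * D / √n)
        have h4 : -((⌈M * D⌉ : ℤ) : ℝ) - 1 < l := by linarith [Int.le_ceil (M * D)]
        exact_mod_cast h4.le
      · exact Int.floor_le_ceil _ |>.trans (Int.ceil_le_ceil h2.2)
    · refine (norm_toEuclideanLin_sub_le (hS x (hRS hxR)) hμ' hW hμM hx h3).trans ?_
      calc 2 * (M * √n) * (2 / D) + √n / D = (4 * M + 1) * (√n / D) := by ring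
        _ ≤ z * (√n / D) := by gcongr; linarith
        _ = _ := by ring
  have hcard : (Λ.card : ℝ) ≤ 2 * z * D := by
    have h0 : 0 ≤ ⌈M * D⌉ := Int.ceil_nonneg (by positivity)
    have h1 : (Λ.card : ℤ) = 2 * ⌈M * D⌉ + 2 := by
      rw [hΛ, Int.card_Icc, Int.toNat_of_nonneg (by linarith)]; ring
    have h2 : (Λ.card : ℝ) = 2 * (⌈M * D⌉ : ℤ) + 2 := by exact_mod_cast h1
    rw [h2]
    have h3 := (Int.ceil_lt_add_one (M * D)).le
    have h4 : M * D ≤ z / 5 * D := by gcongr; linarith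
    nlinarith
  calc _ ≤ ∑ x ∈ R, ∑ l ∈ Λ, P.real
        {ω | ‖Matrix.toEuclideanLin (W ω) x - ((l : ℝ) * √n / D) • x‖ ≤ z / D * √n} := by
        refine (measureReal_mono hsub (measure_ne_top _ _)).trans ?_
        refine (measureReal_biUnion_finset_le R _).trans (Finset.sum_le_sum fun x _ => ?_)
        exact measureReal_biUnion_finset_le Λ _
    _ ≤ ∑ _x ∈ R, ∑ _l ∈ Λ, b :=
        Finset.sum_le_sum fun x hx => Finset.sum_le_sum fun l _ => hb x hx _
    _ = R.card * Λ.card * b := by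
        simp only [Finset.sum_const, nsmul_eq_mul]; ring
    _ ≤ _ := by
        rcases R.eq_empty_or_nonempty with rfl | ⟨x, hx⟩
        · simp
        · have hb0 : 0 ≤ b := measureReal_nonneg.trans (hb x hx 0)
          gcongr

/-- The probability that there is an eigenvector of regularized LCD in `[D - 1, D)`: the number of
codes is compensated by the small ball estimate, up to a factor `D ^ m / √n ^ (k * m)`. -/
lemma measureReal_level_le [IsProbabilityMeasure P] [IsProbabilityMeasure P₀]
    (hW : IsWigner P P₀ ξ ζ W) (hξ : Measurable ξ) {ε₀ p₀ K₀ M c₀ c₁ γ L z b₀ b₁ : ℝ}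
    (hnd : Nondegenerate P₀ ξ ε₀ p₀ K₀) (hε₀ : 0 < ε₀) (hK₀ : 0 < K₀) (hM : 1 ≤ M)
    {spread : EuclideanSpace ℝ (Fin n) → Finset (Fin n)} (hs : IsSpread c₀ c₁ spread)
    {k m D : ℕ} (hn : 0 < n) (hk : 1 ≤ k) (hm : m = ⌈γ * n⌉₊)
    (hkm : k * m ≤ ⌈spreadConst c₀ c₁ * n⌉₊) (hD : 1 ≤ D)
    (hb₀ : 0 < b₀) (hb₁ : 0 < b₁)
    (hlow : ∀ v ∈ incomp c₀ c₁ n, ∀ I ⊆ spread v, I.card = m → b₀ ≤ ‖restrict v I‖)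
    (hup : ∀ v ∈ incomp c₀ c₁ n, ∀ i ∈ spread v, |v i| ≤ b₁ / √n)
    (hL : 1 ≤ L) (hLz : L ≤ z) (hLp : 1 ≤ p₀ * L ^ 2)
    (hz : 6 ≤ z) (hMz : 5 * M ≤ z) (hzn : z ^ 2 ≤ √n) (hlog : Real.log D ≤ z ^ 2)
    (hz₀ : 1 / b₀ ≤ z) (hz₁ : 4 * b₁ / b₀ ≤ z) (hzε : 8 * Real.pi / (ε₀ * b₀) + 1 ≤ z)
    (htail : 2 * Real.exp (-(z / (2 * K₀)) ^ 2 / 2) ≤ 1 / D) :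
    P.real {ω | (∃ v : EuclideanSpace ℝ (Fin n), IsEigenvector (W ω) v ∧
        v ∈ {v | v ∈ incomp c₀ c₁ n ∧ ((D - 1 : ℕ) : ℝ) ≤ regLCD spread L γ v ∧
          regLCD spread L γ v < D}) ∧ spectralNorm (W ω) ≤ M * √n} ≤
      ((k + 1 : ℕ) : ℝ) ^ n * (z * (D : ℝ) ^ 2 + 1) ^ (k + 1) *
        (Real.exp (2 * (k + 1) * n) * (z ^ 7 * D) ^ n * (1 / √n) ^ (k * m)) * (2 * z * D) *
        (Real.exp (n / 2) * (z ^ 3 / D) ^ (n - m)) := by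
  have hn0 : (0 : ℝ) < n := by exact_mod_cast hn
  have hN : 0 < √(n : ℝ) := Real.sqrt_pos.2 hn0
  have hz0 : 0 < z := by linarith
  have hD1 : (1 : ℝ) ≤ D := by exact_mod_cast hD
  have hD0 : (0 : ℝ) < D := by linarith
  have hpi := Real.pi_pos
  set S : Set (EuclideanSpace ℝ (Fin n)) := {v | v ∈ incomp c₀ c₁ n ∧
    ((D - 1 : ℕ) : ℝ) ≤ regLCD spread L γ v ∧ regLCD spread L γ v < D} with hSdef
  have hS1 : ∀ v ∈ S, ‖v‖ = 1 := fun v hv => hv.1.1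
  have happ : ∀ v ∈ S, ∃ (χ : Fin n → Fin (k + 1)) (s : Fin (k + 1) → ℝ) (p : Fin n → ℤ),
      BlockApprox z D (k * m) v χ s p := fun v hv =>
    exists_blockApprox (hS1 v hv) hn hD hm (by rw [(hs v hv.1).1]; exact hkm) hb₀ hb₁
      (hlow v hv.1) (hup v hv.1) hL hLz hlog hz₀ hz₁ hv.2.2
  obtain ⟨T, hTc, hT⟩ := exists_codes k (k * m) hn hD hz ((le_self_pow₀ (by linarith)
    (by norm_num)).trans hzn)
  obtain ⟨R, hRS, hRT, hnet⟩ := exists_net_of_hasCode hn hD T S hS1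
    fun v hv => hT v (hS1 v hv) (happ v hv)
  have hball : ∀ x ∈ R, ∀ ν : ℝ,
      P.real {ω | ‖Matrix.toEuclideanLin (W ω) x - ν • x‖ ≤ z / D * √n} ≤
        Real.exp (n / 2) * (z ^ 3 / D) ^ (n - m) := by
    intro x hx ν
    have hxS := hRS hx
    have hcard : ⌈γ * n⌉₊ ≤ (spread x).card := by
      rw [(hs x hxS.1).1, ← hm]
      exact (Nat.le_mul_of_pos_left m hk).trans hkm
    obtain ⟨I, hIs, hIm, hreg⟩ := exists_lcd_eq_regLCD (L := L) hcard
    have hr := hlow x hxS.1 I hIs (hIm.trans hm.symm)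
    have hr1 : ‖restrict x I‖ ≤ 1 := (norm_restrict_le x I).trans (hS1 x hxS).le
    -- the level cannot be `D = 1`: the dilation factor of a block lies in `[2 √n / z, z D]`
    have hD2 : (2 : ℝ) ≤ D := by
      obtain ⟨χ, s, p, h⟩ := happ x hxS
      have hne : Fin.last k ≠ 0 := by
        rw [Ne, Fin.ext_iff]; simp; omega
      have h1 := (h.lower _ hne).trans (h.upper _ hne)
      rw [div_le_iff₀ hz0] at h1
      have h2 : 2 * z ^ 2 ≤ z ^ 2 * D := by nlinarith
      nlinarith [pow_pos hz0 2]
    have hD' : (D : ℝ) / 2 ≤ ((D - 1 : ℕ) : ℝ) := by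
      rw [Nat.cast_sub hD]; push_cast; linarith
    have hDpos : (0 : ℝ) < ((D - 1 : ℕ) : ℝ) := by linarith
    have : IsProbabilityMeasure (P₀.map ξ) := Measure.isProbabilityMeasure_map hξ.aemeasurable
    have h2 : (P₀.map ξ).real {x | K₀ < |x|} ≤ p₀ / 4 := by
      rw [map_measureReal_apply hξ (measurableSet_lt measurable_const (by fun_prop))]
      exact hnd.2
    have hQ := integral_gaussianReal_prod_norm_charFun_le hnd.1 h2 hε₀ hK₀ (by linarith) hLp
      (div_pos hz0 hD0) hDpos (hb₀.trans_le hr) hr1 (hreg ▸ hxS.2.1)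
    refine (hW.measureReal_norm_sub_le hξ x I ν (div_pos hz0 hD0)).trans ?_
    rw [hIm, ← hm]
    refine mul_le_mul_of_nonneg_left ?_ (Real.exp_nonneg _)
    refine pow_le_pow_left₀ (integral_nonneg fun g =>
      Finset.prod_nonneg fun _ _ => norm_nonneg _) (hQ.trans ?_) _
    have t1 : 8 * Real.pi * L * (z / D) / (ε₀ * ‖restrict x I‖) ≤ (z - 1) * (z ^ 2 / D) := by
      calc 8 * Real.pi * L * (z / D) / (ε₀ * ‖restrict x I‖)
          ≤ 8 * Real.pi * z * (z / D) / (ε₀ * b₀) := by gcongr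
        _ = 8 * Real.pi / (ε₀ * b₀) * (z ^ 2 / D) := by ring
        _ ≤ _ := by gcongr; linarith
    have t2 : 2 * Real.exp (-(z / D * ((D - 1 : ℕ) : ℝ) / K₀) ^ 2 / 2) ≤ 1 * (z ^ 2 / D) := by
      have h3 : z / (2 * K₀) ≤ z / D * ((D - 1 : ℕ) : ℝ) / K₀ := by
        calc z / (2 * K₀) = z / D * (D / 2) / K₀ := by field_simp
          _ ≤ _ := by gcongr
      calc 2 * Real.exp (-(z / D * ((D - 1 : ℕ) : ℝ) / K₀) ^ 2 / 2)
          ≤ 2 * Real.exp (-(z / (2 * K₀)) ^ 2 / 2) := by gcongr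
        _ ≤ 1 / D := htail
        _ ≤ z ^ 2 / D := by gcongr; nlinarith
        _ = _ := (one_mul _).symm
    calc _ ≤ (z - 1) * (z ^ 2 / D) + 1 * (z ^ 2 / D) := add_le_add t1 t2
      _ = z ^ 3 / D := by ring
  refine (measureReal_exists_eigenvector_le R hn hD hM hz hMz hS1 hRS hnet hball).trans ?_
  have hRc : (R.card : ℝ) ≤ T.card := by exact_mod_cast hRT
  gcongr
  exact hRc.trans hTc

end

/-! ### Choice of parameters and conclusion -/

/-- The union bound at level `D`, with all constants absorbed in powers of `z`. -/
lemma level_bound_le {n k m : ℕ} {z D Y : ℝ} (hmn : m ≤ n) (hz : 1 ≤ z) (hD : 1 ≤ D) (hDY : D ≤ Y)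
    (hk : ((k + 1 : ℕ) : ℝ) ≤ z) (he : Real.exp (2 * (k + 1)) ≤ z) :
    ((k + 1 : ℕ) : ℝ) ^ n * (z * D ^ 2 + 1) ^ (k + 1) *
        (Real.exp (2 * (k + 1) * n) * (z ^ 7 * D) ^ n * (1 / √n) ^ (k * m)) * (2 * z * D) *
        (Real.exp (n / 2) * (z ^ 3 / D) ^ (n - m)) ≤
      (z * Y ^ 2 + 1) ^ (k + 1) * (2 * z * Y) * z ^ (13 * n) * Y ^ m * (1 / √n) ^ (k * m) := by
  have hD0 : 0 < D := by linarith
  have hz0 : 0 < z := by linarith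
  have e1 : Real.exp (2 * (k + 1) * n) ≤ z ^ n := by
    rw [mul_comm, Real.exp_nat_mul]; gcongr
  have e2 : Real.exp (n / 2) ≤ z ^ n := by
    refine le_trans (Real.exp_le_exp.2 ?_) e1
    have h1 : (0 : ℝ) ≤ k * n := by positivity
    have h2 : (0 : ℝ) ≤ n := by positivity
    nlinarith
  have e3 : (z ^ 7 * D) ^ n * (z ^ 3 / D) ^ (n - m) ≤ z ^ (10 * n) * D ^ m := by
    have h1 : (z ^ 3) ^ (n - m) ≤ (z ^ 3) ^ n :=
      pow_le_pow_right₀ (one_le_pow₀ hz) (Nat.sub_le _ _)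
    have h2 : D ^ n = D ^ m * D ^ (n - m) := by rw [← pow_add, Nat.add_sub_cancel' hmn]
    have h3 : D ^ (n - m) ≠ 0 := (pow_pos hD0 _).ne'
    calc (z ^ 7 * D) ^ n * (z ^ 3 / D) ^ (n - m)
        = (z ^ 7) ^ n * (z ^ 3) ^ (n - m) * D ^ m := by
          rw [mul_pow, div_pow, h2]; field_simp
      _ ≤ (z ^ 7) ^ n * (z ^ 3) ^ n * D ^ m := by gcongr
      _ = _ := by rw [← pow_mul, ← pow_mul, ← pow_add]; congr 2; ring
  calc _ = ((k + 1 : ℕ) : ℝ) ^ n * (z * D ^ 2 + 1) ^ (k + 1) * (2 * z * D) *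
        (Real.exp (2 * (k + 1) * n) * Real.exp (n / 2) *
          ((z ^ 7 * D) ^ n * (z ^ 3 / D) ^ (n - m))) * (1 / √n) ^ (k * m) := by ring
    _ ≤ z ^ n * (z * Y ^ 2 + 1) ^ (k + 1) * (2 * z * Y) *
        (z ^ n * z ^ n * (z ^ (10 * n) * Y ^ m)) * (1 / √n) ^ (k * m) := by
        have e4 := e3.trans (by gcongr : z ^ (10 * n) * D ^ m ≤ z ^ (10 * n) * Y ^ m)
        have hY0 : 0 ≤ Y := by linarith
        gcongr
    _ = _ := by
        have : z ^ (13 * n) = z ^ n * z ^ n * z ^ n * z ^ (10 * n) := by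
          rw [← pow_add, ← pow_add, ← pow_add]; congr 1; ring
        rw [this]; ring

/-- For large `n`, the power `z = n ^ δ` exceeds any constant, while polynomial factors are at most
`exp (η z ^ 2)` and `z ^ n`. -/
lemma exists_forall_large {α δ η : ℝ} (hα : 0 < α) (hδ : 0 < δ) (hη : 0 < η) (k : ℕ) (Z N : ℝ) :
    ∃ n₀ : ℕ, 1 ≤ n₀ ∧ ∀ n : ℕ, n₀ ≤ n → Z ≤ (n : ℝ) ^ δ ∧ N ≤ n ∧
      2 * (2 * (n : ℝ) ^ α) ≤ Real.exp (η * ((n : ℝ) ^ δ) ^ 2) ∧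
      ((n : ℝ) ^ δ * (2 * (n : ℝ) ^ α) ^ 2 + 1) ^ (k + 1) *
        (2 * (n : ℝ) ^ δ * (2 * (n : ℝ) ^ α)) * (2 * (n : ℝ) ^ α) ≤ ((n : ℝ) ^ δ) ^ n := by
  have hcast := tendsto_natCast_atTop_atTop (R := ℝ)
  have hz : Filter.Tendsto (fun n : ℕ => (n : ℝ) ^ δ) Filter.atTop Filter.atTop :=
    (tendsto_rpow_atTop hδ).comp hcast
  have hz2 : Filter.Tendsto (fun n : ℕ => (n : ℝ) ^ (2 * δ)) Filter.atTop Filter.atTop :=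
    (tendsto_rpow_atTop (by positivity)).comp hcast
  have hexp := (isLittleO_rpow_exp_pos_mul_atTop (α / (2 * δ)) hη).bound
    (by norm_num : (0 : ℝ) < 1 / 4)
  set a : ℕ := ⌈α / δ⌉₊ + 1 with ha
  have hev := (hz.eventually_ge_atTop (max Z 2)).and ((hcast.eventually_ge_atTop N).and
    ((hz2.eventually hexp).and ((Filter.eventually_ge_atTop
      ((2 * a + 2) * (k + 1) + (2 * a + 2))).and (Filter.eventually_ge_atTop 1))))
  obtain ⟨n₀, hn₀⟩ := Filter.eventually_atTop.1 hev
  refine ⟨max n₀ 1, le_max_right _ _, fun n hn => ?_⟩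
  obtain ⟨h1, h2, h3, h4, h5⟩ := hn₀ n ((le_max_left _ _).trans hn)
  have hn0 : (0 : ℝ) ≤ n := Nat.cast_nonneg _
  refine ⟨(le_max_left _ _).trans h1, h2, ?_, ?_⟩
  · rw [← Real.rpow_mul hn0, Real.norm_of_nonneg (by positivity),
      Real.norm_of_nonneg (Real.exp_nonneg _)] at h3
    have e1 : 2 * δ * (α / (2 * δ)) = α := by field_simp
    have e2 : ((n : ℝ) ^ δ) ^ 2 = (n : ℝ) ^ (2 * δ) := by
      rw [← Real.rpow_natCast, ← Real.rpow_mul hn0]; congr 1; push_cast; ring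
    rw [e1] at h3
    rw [e2]
    linarith
  · set z : ℝ := (n : ℝ) ^ δ with hzdef
    have hz2 : 2 ≤ z := (le_max_right _ _).trans h1
    have hz1 : 1 ≤ z := by linarith
    have hY : 2 * (n : ℝ) ^ α ≤ z ^ a := by
      have e1 : (n : ℝ) ^ α = z ^ (α / δ) := by
        rw [hzdef, ← Real.rpow_mul hn0]; congr 1; field_simp
      have e2 : z ^ (α / δ) ≤ z ^ ⌈α / δ⌉₊ := by
        rw [← Real.rpow_natCast]
        exact Real.rpow_le_rpow_of_exponent_le hz1 (Nat.le_ceil _)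
      rw [e1, ha, pow_succ, mul_comm]
      gcongr
    have hY0 : 0 ≤ 2 * (n : ℝ) ^ α := by positivity
    have f1 : z * (2 * (n : ℝ) ^ α) ^ 2 + 1 ≤ z ^ (2 * a + 2) := by
      have : z * (2 * (n : ℝ) ^ α) ^ 2 ≤ z ^ (2 * a + 1) := by
        calc z * (2 * (n : ℝ) ^ α) ^ 2 ≤ z * (z ^ a) ^ 2 := by gcongr
          _ = _ := by ring
      have h6 : 1 ≤ z ^ (2 * a + 1) := one_le_pow₀ hz1
      have h7 : z ^ (2 * a + 2) = z * z ^ (2 * a + 1) := by ring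
      nlinarith
    calc _ ≤ (z ^ (2 * a + 2)) ^ (k + 1) * (z * z * z ^ a) * z ^ a := by gcongr
      _ = z ^ ((2 * a + 2) * (k + 1) + (2 * a + 2)) := by
        rw [← pow_mul]; ring
      _ ≤ z ^ n := pow_le_pow_right₀ hz1 h4

lemma regLCD_nonneg {n : ℕ} (spread : EuclideanSpace ℝ (Fin n) → Finset (Fin n))
    (L γ : ℝ) (x : EuclideanSpace ℝ (Fin n)) : 0 ≤ regLCD spread L γ x := by
  refine Real.sSup_nonneg ?_
  rintro D ⟨I, -, -, rfl⟩
  exact Real.sInf_nonneg fun θ hθ => hθ.1.le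

/-- The gain `√n ^ (k * m)` from `k` blocks of size `m ≈ γ n` beats the loss `n ^ (α m)` from the
block that the small ball estimate gives up. -/
lemma sum_bound_le_rpow {n k m : ℕ} {α c₂ γ z : ℝ} (hn1 : (1 : ℝ) ≤ n)
    (hkα : 8 * α ≤ k) (hγk : k * γ = c₂ / 2) (hmn : m ≤ n) (hm1 : γ * n ≤ m)
    (hz : z = (n : ℝ) ^ (c₂ / 160)) (hz2 : 2 ≤ z)
    (hpoly : (z * (2 * (n : ℝ) ^ α) ^ 2 + 1) ^ (k + 1) * (2 * z * (2 * (n : ℝ) ^ α)) *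
      (2 * (n : ℝ) ^ α) ≤ z ^ n) :
    2 * (n : ℝ) ^ α * ((z * (2 * (n : ℝ) ^ α) ^ 2 + 1) ^ (k + 1) * (2 * z * (2 * (n : ℝ) ^ α)) *
      z ^ (13 * n) * (2 * (n : ℝ) ^ α) ^ m * (1 / √n) ^ (k * m)) ≤
      (n : ℝ) ^ (-(3 * c₂ / 32 * n)) := by
  have hn0 : (0 : ℝ) < n := by linarith
  have hz0 : 0 < z := by linarith
  have hz1 : 1 ≤ z := by linarith
  set Y : ℝ := 2 * (n : ℝ) ^ α with hY
  have hY0 : 0 < Y := by positivity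
  calc Y * ((z * Y ^ 2 + 1) ^ (k + 1) * (2 * z * Y) *
          z ^ (13 * n) * Y ^ m * (1 / √n) ^ (k * m))
      = ((z * Y ^ 2 + 1) ^ (k + 1) * (2 * z * Y) * Y) *
          (z ^ (13 * n) * Y ^ m * (1 / √n) ^ (k * m)) := by ring
    _ ≤ z ^ n * (z ^ (13 * n) * (z ^ n * ((n : ℝ) ^ α) ^ m) * (1 / √n) ^ (k * m)) := by
        have h1 : Y ^ m ≤ z ^ n * ((n : ℝ) ^ α) ^ m := by
          rw [hY, mul_pow]
          gcongr
          exact (pow_le_pow_left₀ (by norm_num) hz2 m).trans (pow_le_pow_right₀ hz1 hmn)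
        gcongr
    _ = (n : ℝ) ^ (15 * (c₂ / 160) * n + α * m - k * m / 2) := by
        have e1 : z ^ n * (z ^ (13 * n) * z ^ n) = (n : ℝ) ^ (15 * (c₂ / 160) * n) := by
          rw [← pow_add, ← pow_add, hz, ← Real.rpow_natCast, ← Real.rpow_mul hn0.le]
          congr 1
          push_cast
          ring
        have e2 : ((n : ℝ) ^ α) ^ m = (n : ℝ) ^ (α * m) := by
          rw [← Real.rpow_natCast, ← Real.rpow_mul hn0.le]
        have e3 : (1 / √(n : ℝ)) ^ (k * m) = (n : ℝ) ^ (-(k * m / 2 : ℝ)) := by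
          rw [Real.sqrt_eq_rpow, one_div, ← Real.rpow_neg hn0.le, ← Real.rpow_natCast,
            ← Real.rpow_mul hn0.le]
          congr 1
          push_cast
          ring
        rw [sub_eq_add_neg, Real.rpow_add hn0, Real.rpow_add hn0, ← e1, ← e2, ← e3]
        ring
    _ ≤ (n : ℝ) ^ (-(3 * c₂ / 32 * n)) := by
        refine Real.rpow_le_rpow_of_exponent_le hn1 ?_
        have h1 : α * m ≤ k / 8 * m := by gcongr; linarith
        have h2 : c₂ / 2 * n ≤ k * m := by
          rw [← hγk, mul_assoc]
          gcongr
        linarith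

section

variable {Ω Ω₀ : Type*} [MeasurableSpace Ω] [MeasurableSpace Ω₀] {P : Measure Ω}
  {P₀ : Measure Ω₀} {ξ ζ : Ω₀ → ℝ} {n : ℕ} {W : Ω → Matrix (Fin n) (Fin n) ℝ}

/-- The theorem for one large `n`, in terms of `z = n ^ (c₂ / 160)`: a union bound over the unit
intervals in which the regularized LCD may lie. -/
lemma measureReal_exists_small_regLCD_le [IsProbabilityMeasure P] [IsProbabilityMeasure P₀]
    (hW : IsWigner P P₀ ξ ζ W) (hξ : Measurable ξ) {ε₀ p₀ K₀ M α c₀ c₁ c₂ γ L z b₀ η : ℝ}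
    (hnd : Nondegenerate P₀ ξ ε₀ p₀ K₀) (hε₀ : 0 < ε₀) (hK₀ : 0 < K₀) (hM : 1 ≤ M) (hα : 0 < α)
    (hc₀0 : 0 < c₀) (hc₁0 : 0 < c₁) (hc₂ : c₂ = spreadConst c₀ c₁)
    (hc₂1 : c₂ < 1 / 4)
    {spread : EuclideanSpace ℝ (Fin n) → Finset (Fin n)} (hspread : IsSpread c₀ c₁ spread)
    {k : ℕ} (hn : 0 < n) (hk1 : 1 ≤ k) (hkα : 8 * α ≤ k) (hγ0 : 0 < γ) (hγk : k * γ = c₂ / 2)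
    (hb₀ : b₀ = c₁ * √(γ / 2))
    (hL1 : 1 ≤ L) (hLp : 1 ≤ p₀ * L ^ 2) (hz : z = (n : ℝ) ^ (c₂ / 160)) (hLz : L ≤ z)
    (hz6 : 6 ≤ z) (hMz : 5 * M ≤ z) (hz₀ : 1 / b₀ ≤ z) (hz₁ : 4 * (1 / √c₀) / b₀ ≤ z)
    (hzε : 8 * Real.pi / (ε₀ * b₀) + 1 ≤ z) (hkz : ((k + 1 : ℕ) : ℝ) ≤ z)
    (hez : Real.exp (2 * (k + 1)) ≤ z) (hnγ : 1 / γ ≤ n)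
    (hη1 : η ≤ 1) (hη2 : η ≤ 1 / (8 * K₀ ^ 2))
    (hexp : 2 * (2 * (n : ℝ) ^ α) ≤ Real.exp (η * z ^ 2))
    (hpoly : (z * (2 * (n : ℝ) ^ α) ^ 2 + 1) ^ (k + 1) * (2 * z * (2 * (n : ℝ) ^ α)) *
      (2 * (n : ℝ) ^ α) ≤ z ^ n) :
    P.real {ω | (∃ v : EuclideanSpace ℝ (Fin n), IsEigenvector (W ω) v ∧ v ∈ incomp c₀ c₁ n ∧
        regLCD spread L γ v ≤ (n : ℝ) ^ α) ∧ spectralNorm (W ω) ≤ M * √(n : ℝ)} ≤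
      (n : ℝ) ^ (-(3 * c₂ / 32 * n)) := by
  have hn0 : (0 : ℝ) < n := by exact_mod_cast hn
  have hn1 : (1 : ℝ) ≤ n := by exact_mod_cast hn
  have hk1' : (1 : ℝ) ≤ k := by exact_mod_cast hk1
  have hb₀0 : 0 < b₀ := by rw [hb₀]; positivity
  have hb₁0 : 0 < 1 / √c₀ := by positivity
  have hγ1 : γ ≤ c₂ / 2 := by rw [← hγk]; exact le_mul_of_one_le_left hγ0.le hk1'
  have hz1 : 1 ≤ z := by linarith
  have hzn : z ^ 2 ≤ √n := by
    rw [Real.sqrt_eq_rpow, hz, ← Real.rpow_natCast, ← Real.rpow_mul hn0.le]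
    refine Real.rpow_le_rpow_of_exponent_le hn1 ?_
    push_cast
    linarith
  obtain ⟨m, hm⟩ : ∃ m : ℕ, m = ⌈γ * n⌉₊ := ⟨_, rfl⟩
  have hγn1 : 1 ≤ γ * n := by
    rw [div_le_iff₀ hγ0] at hnγ; linarith
  have hm1 : γ * n ≤ m := hm ▸ Nat.le_ceil _
  have hm2 : (m : ℝ) ≤ 2 * (γ * n) := by
    have := Nat.ceil_lt_add_one (by positivity : 0 ≤ γ * n)
    rw [← hm] at this
    linarith
  have hkmR : (k : ℝ) * m ≤ c₂ * n := by
    calc (k : ℝ) * m ≤ k * (2 * (γ * n)) := by gcongr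
      _ = 2 * (k * γ) * n := by ring
      _ = c₂ * n := by rw [hγk]; ring
  have hkm : k * m ≤ ⌈c₂ * n⌉₊ := by
    have : ((k * m : ℕ) : ℝ) ≤ (⌈c₂ * n⌉₊ : ℕ) := by
      push_cast
      exact hkmR.trans (Nat.le_ceil _)
    exact_mod_cast this
  have hmn : m ≤ n := by
    have : (m : ℝ) ≤ n := by nlinarith
    exact_mod_cast this
  have hlow : ∀ v ∈ incomp c₀ c₁ n, ∀ I ⊆ spread v, I.card = m →
      b₀ ≤ ‖restrict v I‖ := fun v hv I hI hIm =>
    hb₀ ▸ le_norm_restrict hn hc₁0 hγ0 (by rw [hIm]; exact hm1)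
      fun i hi => ((hspread v hv).2 i (hI hi)).1
  have hup : ∀ v ∈ incomp c₀ c₁ n, ∀ i ∈ spread v, |v i| ≤ 1 / √c₀ / √n := by
    intro v hv i hi
    refine ((hspread v hv).2 i hi).2.trans_eq ?_
    rw [Real.sqrt_mul hc₀0.le, div_div]
  obtain ⟨Y, hY⟩ : ∃ Y : ℝ, Y = 2 * (n : ℝ) ^ α := ⟨_, rfl⟩
  rw [← hY] at hexp
  have hYn : (n : ℝ) ^ α + 1 ≤ Y := by
    have : 1 ≤ (n : ℝ) ^ α := Real.one_le_rpow hn1 hα.le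
    rw [hY]; linarith
  have hDY : ∀ d ∈ Finset.range (⌊(n : ℝ) ^ α⌋₊ + 1), ((d + 1 : ℕ) : ℝ) ≤ Y := by
    intro d hd
    have h1 : (d : ℝ) ≤ ⌊(n : ℝ) ^ α⌋₊ := by
      exact_mod_cast Nat.lt_succ_iff.1 (Finset.mem_range.1 hd)
    have h2 := Nat.floor_le (by positivity : 0 ≤ (n : ℝ) ^ α)
    push_cast
    linarith
  have hlevel : ∀ d ∈ Finset.range (⌊(n : ℝ) ^ α⌋₊ + 1),
      P.real {ω | (∃ v : EuclideanSpace ℝ (Fin n), IsEigenvector (W ω) v ∧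
        v ∈ {v | v ∈ incomp c₀ c₁ n ∧
          ((d + 1 - 1 : ℕ) : ℝ) ≤ regLCD spread L γ v ∧
          regLCD spread L γ v < (d + 1 : ℕ)}) ∧
        spectralNorm (W ω) ≤ M * √n} ≤
      (z * Y ^ 2 + 1) ^ (k + 1) * (2 * z * Y) * z ^ (13 * n) * Y ^ m * (1 / √n) ^ (k * m) := by
    intro d hd
    have hD := hDY d hd
    have hD1 : (1 : ℝ) ≤ ((d + 1 : ℕ) : ℝ) := by push_cast; linarith [Nat.cast_nonneg (α := ℝ) d]
    have hDexp : 2 * ((d + 1 : ℕ) : ℝ) ≤ Real.exp (η * z ^ 2) := by linarith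
    refine (measureReal_level_le hW hξ hnd hε₀ hK₀ hM hspread hn hk1 hm (hc₂ ▸ hkm)
      (Nat.le_add_left 1 d) hb₀0 hb₁0 hlow hup hL1 hLz hLp hz6 hMz hzn ?_ hz₀ hz₁ hzε ?_).trans
      (level_bound_le hmn hz1 hD1 hD hkz hez)
    · rw [Real.log_le_iff_le_exp (by linarith)]
      refine (by linarith : ((d + 1 : ℕ) : ℝ) ≤ Real.exp (η * z ^ 2)).trans
        (Real.exp_le_exp.2 ?_)
      exact mul_le_of_le_one_left (by positivity) (hη1)
    · have h1 : -(z / (2 * K₀)) ^ 2 / 2 = -(1 / (8 * K₀ ^ 2) * z ^ 2) := by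
        field_simp; norm_num
      have h2 : Real.exp (η * z ^ 2) ≤ Real.exp (1 / (8 * K₀ ^ 2) * z ^ 2) :=
        Real.exp_le_exp.2 (by gcongr)
      rw [h1, Real.exp_neg, ← div_eq_mul_inv, div_le_div_iff₀ (Real.exp_pos _) (by linarith)]
      linarith
  have hcover : {ω | (∃ v : EuclideanSpace ℝ (Fin n),
        IsEigenvector (W ω) v ∧ v ∈ incomp c₀ c₁ n ∧
        regLCD spread L γ v ≤ (n : ℝ) ^ α) ∧
      spectralNorm (W ω) ≤ M * √(n : ℝ)} ⊆
      ⋃ d ∈ Finset.range (⌊(n : ℝ) ^ α⌋₊ + 1),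
        {ω | (∃ v : EuclideanSpace ℝ (Fin n), IsEigenvector (W ω) v ∧
          v ∈ {v | v ∈ incomp c₀ c₁ n ∧
            ((d + 1 - 1 : ℕ) : ℝ) ≤ regLCD spread L γ v ∧
            regLCD spread L γ v < (d + 1 : ℕ)}) ∧
          spectralNorm (W ω) ≤ M * √n} := by
    rintro ω ⟨⟨v, hv, hvi, hvr⟩, hω⟩
    have h0 := regLCD_nonneg spread L γ v
    refine Set.mem_biUnion (x := ⌊regLCD spread L γ v⌋₊) ?_ ⟨⟨v, hv, hvi, ?_, ?_⟩, hω⟩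
    · exact Finset.mem_coe.2 (Finset.mem_range.2 (Nat.lt_succ_iff.2 (Nat.floor_le_floor hvr)))
    · exact Nat.floor_le h0
    · push_cast
      exact Nat.lt_floor_add_one _
  have hz0 : 0 < z := by linarith
  have hY0 : 0 < Y := by rw [hY]; positivity
  set B : ℝ := (z * Y ^ 2 + 1) ^ (k + 1) * (2 * z * Y) * z ^ (13 * n) * Y ^ m *
    (1 / √n) ^ (k * m) with hB
  have hB0 : 0 ≤ B := by positivity
  calc _ ≤ ∑ _d ∈ Finset.range (⌊(n : ℝ) ^ α⌋₊ + 1), B := by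
        refine (measureReal_mono hcover (measure_ne_top _ _)).trans ?_
        exact (measureReal_biUnion_finset_le _ _).trans (Finset.sum_le_sum hlevel)
    _ = ((⌊(n : ℝ) ^ α⌋₊ + 1 : ℕ) : ℝ) * B := by
        rw [Finset.sum_const, Finset.card_range, nsmul_eq_mul]
    _ ≤ Y * B := mul_le_mul_of_nonneg_right
        (hDY _ (Finset.mem_range.2 (Nat.lt_succ_self _))) hB0
    _ ≤ _ := by
        rw [hB, hY]
        exact sum_bound_le_rpow hn1 hkα hγk hmn hm1 hz (by linarith) hpoly

end

end WignerLCD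

theorem theorem7p4 (ε₀ p₀ K₀ M α c₀ c₁ : ℝ)
    (hε₀ : 0 < ε₀) (hp₀ : 0 < p₀) (hK₀ : 0 < K₀) (hM : 1 ≤ M) (hα : 0 < α)
    (hc₀ : c₀ ∈ Set.Ioo (0 : ℝ) 1) (hc₁ : c₁ ∈ Set.Ioo (0 : ℝ) 1) :
    ∃ C c c' γ : ℝ, 0 < C ∧ 0 < c ∧ 0 < c' ∧
      γ ∈ Set.Ioo 0 (WignerLCD.spreadConst c₀ c₁) ∧
      ∀ (Ω₀ : Type*) [MeasurableSpace Ω₀] (P₀ : MeasureTheory.Measure Ω₀)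
        [MeasureTheory.IsProbabilityMeasure P₀] (ξ ζ : Ω₀ → ℝ),
        Measurable ξ → Measurable ζ → WignerLCD.Nondegenerate P₀ ξ ε₀ p₀ K₀ →
      ∀ (n : ℕ) (Ω : Type*) [MeasurableSpace Ω] (P : MeasureTheory.Measure Ω)
        [MeasureTheory.IsProbabilityMeasure P] (W : Ω → Matrix (Fin n) (Fin n) ℝ),
        WignerLCD.IsWigner P P₀ ξ ζ W →
      ∀ spread : EuclideanSpace ℝ (Fin n) → Finset (Fin n),
        WignerLCD.IsSpread c₀ c₁ spread →
      ∀ L : ℝ, p₀ ^ (-(1 / 2) : ℝ) ≤ L → L ≤ (n : ℝ) ^ c →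
        P.real {ω | (∃ v : EuclideanSpace ℝ (Fin n),
              WignerLCD.IsEigenvector (W ω) v ∧ v ∈ WignerLCD.incomp c₀ c₁ n ∧
              WignerLCD.regLCD spread L γ v ≤ (n : ℝ) ^ α) ∧
            WignerLCD.spectralNorm (W ω) ≤ M * √(n : ℝ)}
          ≤ C * (n : ℝ) ^ (-(c' * n)) := by
  obtain ⟨hc₀0, hc₀1⟩ := hc₀
  obtain ⟨hc₁0, hc₁1⟩ := hc₁
  set c₂ := WignerLCD.spreadConst c₀ c₁ with hc₂
  have hc₂0 : 0 < c₂ := by rw [hc₂, WignerLCD.spreadConst]; positivity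
  have hc₂1 : c₂ < 1 / 4 := by
    have h1 : c₁ ^ 2 < 1 := by nlinarith
    have h2 : c₀ * c₁ ^ 2 < 1 := by nlinarith [sq_nonneg c₁]
    rw [hc₂, WignerLCD.spreadConst]; linarith
  -- `k` blocks of size `γ n` fill half of the spread part; enlarging `k` makes the loss `D ^ (γ n)`
  -- from discarding one block negligible against the gain `√n ^ (k γ n)` from all of them
  set k : ℕ := ⌈8 * α⌉₊ with hkdef
  have hk1 : 1 ≤ k := Nat.one_le_iff_ne_zero.2 (Nat.ceil_pos.2 (by positivity)).ne'
  have hk1' : (1 : ℝ) ≤ k := by exact_mod_cast hk1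
  have hkα : 8 * α ≤ k := Nat.le_ceil _
  set γ : ℝ := c₂ / (2 * k) with hγ
  have hγ0 : 0 < γ := by positivity
  have hγk : k * γ = c₂ / 2 := by rw [hγ]; field_simp
  have hγ1 : γ ≤ c₂ / 2 := by rw [← hγk]; exact le_mul_of_one_le_left hγ0.le hk1'
  set δ : ℝ := c₂ / 160 with hδ
  have hδ0 : 0 < δ := by positivity
  set c' : ℝ := 3 * c₂ / 32 with hc'
  have hc'0 : 0 < c' := by positivity
  set b₀ : ℝ := c₁ * √(γ / 2) with hb₀
  have hb₀0 : 0 < b₀ := by positivity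
  set η : ℝ := min 1 (1 / (8 * K₀ ^ 2)) with hη
  have hη0 : 0 < η := lt_min one_pos (by positivity)
  obtain ⟨n₀, hn₀1, hn₀⟩ := WignerLCD.exists_forall_large hα hδ0 hη0 k
    (6 + 5 * M + 1 / b₀ + 4 * (1 / √c₀) / b₀ + (8 * Real.pi / (ε₀ * b₀) + 1) + ((k + 1 : ℕ) : ℝ) +
      Real.exp (2 * (k + 1))) (1 / γ)
  have hn₀R : (1 : ℝ) ≤ n₀ := by exact_mod_cast hn₀1
  refine ⟨(n₀ : ℝ) ^ (c' * n₀), δ, c', γ, by positivity, hδ0, hc'0,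
    ⟨hγ0, by linarith⟩, ?_⟩
  intro Ω₀ _ P₀ _ ξ ζ hξ _ hnd n Ω _ P _ W hW spread hspread L hpL hLn
  have hp₀1 : p₀ ≤ 1 := by
    have h1 := hnd.1
    have h2 := measureReal_nonneg (μ := (P₀.map ξ).prod (P₀.map ξ))
      (s := {z : ℝ × ℝ | |z.1 - z.2| ≤ ε₀})
    linarith
  have hL1 : 1 ≤ L := by
    refine le_trans ?_ hpL
    exact Real.one_le_rpow_of_pos_of_le_one_of_nonpos hp₀ hp₀1 (by norm_num)
  have hLp : 1 ≤ p₀ * L ^ 2 := by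
    have h1 : (p₀ ^ (-(1 / 2) : ℝ)) ^ 2 = p₀⁻¹ := by
      rw [← Real.rpow_natCast, ← Real.rpow_mul hp₀.le, ← Real.rpow_neg_one]
      norm_num
    have h2 : p₀⁻¹ ≤ L ^ 2 := by
      rw [← h1]; gcongr
    calc 1 = p₀ * p₀⁻¹ := (mul_inv_cancel₀ hp₀.ne').symm
      _ ≤ _ := by gcongr
  have hn : 0 < n := by
    rcases Nat.eq_zero_or_pos n with rfl | h
    · rw [Nat.cast_zero, Real.zero_rpow hδ0.ne'] at hLn
      linarith
    · exact h
  have hn0 : (0 : ℝ) < n := by exact_mod_cast hn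
  have hn1 : (1 : ℝ) ≤ n := by exact_mod_cast hn
  rcases lt_or_ge n n₀ with hlt | hge
  · -- for bounded `n` the constant makes the bound trivial
    refine (measureReal_le_one).trans ?_
    have h1 : (n : ℝ) ^ (c' * n) ≤ (n₀ : ℝ) ^ (c' * n₀) := by
      have hle : (n : ℝ) ≤ n₀ := by exact_mod_cast hlt.le
      calc (n : ℝ) ^ (c' * n) ≤ (n₀ : ℝ) ^ (c' * n) := by gcongr
        _ ≤ _ := Real.rpow_le_rpow_of_exponent_le hn₀R (by gcongr)
    rw [Real.rpow_neg hn0.le, ← div_eq_mul_inv, one_le_div (by positivity)]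
    exact h1
  obtain ⟨hZ, hnγ, hexp, hpoly⟩ := hn₀ n hge
  have q1 : 0 < 1 / b₀ := by positivity
  have q2 : 0 < 4 * (1 / √c₀) / b₀ := by positivity
  have q3 : 0 < 8 * Real.pi / (ε₀ * b₀) := by have := Real.pi_pos; positivity
  have q4 : (0 : ℝ) < ((k + 1 : ℕ) : ℝ) := by positivity
  have q5 : 0 < Real.exp (2 * (k + 1)) := Real.exp_pos _
  refine (WignerLCD.measureReal_exists_small_regLCD_le hW hξ hnd hε₀ hK₀ hM hα hc₀0 hc₁0 hc₂
    hc₂1 hspread hn hk1 hkα hγ0 hγk hb₀ hL1 hLp rfl hLn (by linarith) (by linarith) (by linarith)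
    (by linarith) (by linarith) (by linarith) (by linarith) hnγ (min_le_left _ _)
    (min_le_right _ _) hexp hpoly).trans ?_
  refine le_mul_of_one_le_left (by positivity) ?_
  exact Real.one_le_rpow hn₀R (by positivity)
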